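/- Let $\mathbf X=\mathbf X_O\sqcup\mathbf X_H$ be a finite set of discrete random variables with finite domains, where $\mathbf X_O$ are the observed and $\mathbf X_H$ the hidden variables and every variable of $\mathbf X_O$ has at least two values in its domain. Let $P^*$ be a probability distribution over $\mathbf X$ which has a perfect map, i.e. a DAG $\mathcal G^*$ on $\mathbf X$ such that, for all pairwise disjoint $\mathbf U,\mathbf V,\mathbf Z\subseteq\mathbf X$, $\mathbf U$ and $\mathbf V$ are $d$-separated by $\mathbf Z$ in $\mathcal G^*$ if and only if $\mathbf U$ and $\mathbf V$ are conditionally independent given $\mathbf Z$ under $P^*$. Let $P$ be the marginal of $P^*$ over $\mathbf X_O$. Let $R_1,R_2,\dots$ be independent records with distribution $P^*$, let $\mathcal D^*_N=(R_1,\dots,R_N)$, and let $\mathcal D_N$ be the projection of $\mathcal D^*_N$ over $\mathbf X_O$ (the values of the variables of $\mathbf X_H$ are removed). The BIC score over $\mathcal D_N$ of a DAG $\mathcal G$ on $\mathbf X_O$ is $\sum_{X\in\mathbf X_O}S(X\mid \mathrm{Pa}_{\mathcal G}(X))$, where $$S(X\mid\mathbf Z)=\sum_{x}\sum_{\mathbf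 z}N_{x\mathbf z}\log\frac{N_{x\mathbf z}}{N_{\mathbf z}}-\frac12\log(N)\,(|\mathrm{dom}(X)|-1)\prod_{Z\in\mathbf Z}|\mathrm{dom}(Z)| ,$$ $x$ and $\mathbf z$ range over the domains of $X$ and $\mathbf Z$, $N_{x\mathbf z}$ is the number of records of $\mathcal D_N$ with $X=x$ and $\mathbf Z=\mathbf z$, $N_{\mathbf z}=\sum_xN_{x\mathbf z}$, and a term with $N_{x\mathbf z}=0$ is $0$. Then, almost surely, for all sufficiently large $N$, every DAG $\mathcal G$ on $\mathbf X_O$ that maximizes the BIC score over $\mathcal D_N$ among all DAGs on $\mathbf X_O$ is a minimal I-map of $P$: for all pairwise disjoint $\mathbf U,\mathbf V,\mathbf Z\subseteq\mathbf X_O$, if $\mathbf U$ and $\mathbf V$ are $d$-separated by $\mathbf Z$ in $\mathcal G$, then $\mathbf U$ and $\mathbf V$ are conditionally independent given $\mathbf Z$ under $P$ (equivalently, under $P^*$), and no graph obtained from $\mathcal G$ by deleting one or more arcs has this property. -/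

import Mathlib

open MeasureTheory ProbabilityTheory Filter

namespace LatentBN

section Graphs

variable {V : Type*}

/-- A directed graph is a DAG: no node is reachable from itself along a nonempty directed path. -/
def IsDAG (G : Digraph V) : Prop :=
  ∀ v, ¬ Relation.TransGen G.Adj v v

/-- `w` is a descendant of `v`: a child of `v`, or a descendant of a child of `v`. -/
def IsDescendant (G : Digraph V) (v w : V) : Prop :=
  Relation.TransGen G.Adj v w

/-- `⟨c 0, …, c n⟩` is a trail between `X` and `Y`
(the values of `c` beyond `n` are irrelevant). -/
def IsTrail (G : Digraph V) (n : ℕ) (c : ℕ → V) (X Y : V) : Prop :=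
  c 0 = X ∧ c n = Y ∧ ∀ i < n, G.Adj (c i) (c (i + 1)) ∨ G.Adj (c (i + 1)) (c i)

/-- `⟨a, b, c⟩` is a collider: `a → b ← c`. -/
def IsCollider (G : Digraph V) (a b c : V) : Prop :=
  G.Adj a b ∧ G.Adj c b

/-- The trail `⟨c 0, …, c n⟩` is blocked by `Z`: at some interior node `c (i + 1)` there is
either a collider such that neither this node nor any of its descendants is in `Z`,
or a non-collider with this node in `Z`. -/
def IsBlocked (G : Digraph V) (Z : Set V) (n : ℕ) (c : ℕ → V) : Prop :=
  ∃ i, i + 1 < n ∧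
    ((IsCollider G (c i) (c (i + 1)) (c (i + 2)) ∧ c (i + 1) ∉ Z ∧
        ∀ w, IsDescendant G (c (i + 1)) w → w ∉ Z) ∨
      (¬ IsCollider G (c i) (c (i + 1)) (c (i + 2)) ∧ c (i + 1) ∈ Z))

/-- `A` and `B` are `d`-separated by `Z`
(only used for pairwise disjoint sets `A`, `B`, `Z`). -/
def DSep (G : Digraph V) (A B Z : Set V) : Prop :=
  ∀ X ∈ A, ∀ Y ∈ B, ∀ (n : ℕ) (c : ℕ → V), IsTrail G n c X Y → IsBlocked G Z n c

open Classical in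
/-- The set of parents of a node. -/
noncomputable def parents [Fintype V] (G : Digraph V) (v : V) : Finset V :=
  Finset.univ.filter fun u => G.Adj u v

end Graphs

section Independence

variable {V : Type*} {α : V → Type*} [∀ i, MeasurableSpace (α i)]

/-- The event that the variables in `S` take the same values as in the assignment `x`. -/
def agree (S : Set V) (x : ∀ i, α i) : Set (∀ i, α i) :=
  {y | ∀ i ∈ S, y i = x i}

/-- Conditional independence of the discrete variables `A` and `B` given `Z` under `P`
(only used for pairwise disjoint sets `A`, `B`, `Z`): for all values `a`, `b`, `z` one has
`P(a, b, z) P(z) = P(a, z) P(b, z)`. The triple of values is read off from an assignment `x`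
of all the variables. -/
def CondIndep (P : Measure (∀ i, α i)) (A B Z : Set V) : Prop :=
  ∀ x : ∀ i, α i,
    P.real (agree (A ∪ B ∪ Z) x) * P.real (agree Z x) =
      P.real (agree (A ∪ Z) x) * P.real (agree (B ∪ Z) x)

/-- `G` is an independence map of `P`. -/
def IsIMap (G : Digraph V) (P : Measure (∀ i, α i)) : Prop :=
  ∀ A B Z : Set V, Disjoint A B → Disjoint A Z → Disjoint B Z →
    DSep G A B Z → CondIndep P A B Z

/-- `G` is a perfect map of `P`. -/
def IsPerfectMap (G : Digraph V) (P : Measure (∀ i, α i)) : Prop :=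
  ∀ A B Z : Set V, Disjoint A B → Disjoint A Z → Disjoint B Z →
    (DSep G A B Z ↔ CondIndep P A B Z)

/-- `G` is a minimal independence map of `P`: it is an independence map, and deleting a nonempty
set of arcs never leaves an independence map. -/
def IsMinimalIMap (G : Digraph V) (P : Measure (∀ i, α i)) : Prop :=
  IsIMap G P ∧ ∀ H : Digraph V, H < G → ¬ IsIMap H P

end Independence

section Score

variable {V : Type*} {α : V → Type*}

open Classical in
/-- Number of records of the dataset `D` (a list of `N` records) such that `X = x` and `Z = z`. -/
noncomputable def count {N : ℕ} (D : Fin N → ∀ i, α i) (X : V) (x : α X) (Z : Finset V)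
    (z : ∀ i : Z, α i) : ℕ :=
  (Finset.univ.filter fun k : Fin N => D k X = x ∧ ∀ i : Z, D k i = z i).card

variable [∀ i, Fintype (α i)]

/-- Number of free parameters of the conditional distribution of `X` given `Z`. -/
noncomputable def dim (α : V → Type*) [∀ i, Fintype (α i)] (X : V) (Z : Finset V) : ℝ :=
  ((Fintype.card (α X) : ℝ) - 1) * ∏ i ∈ Z, (Fintype.card (α i) : ℝ)

open Classical in
/-- The BIC score `S(X | Z)` of the node `X` with parent set `Z`, with `0 log (0 / m) = 0`. -/
noncomputable def localBIC {N : ℕ} (D : Fin N → ∀ i, α i) (X : V) (Z : Finset V) : ℝ :=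
  (∑ x : α X, ∑ z : (∀ i : Z, α i),
      (count D X x Z z : ℝ) *
        Real.log ((count D X x Z z : ℝ) / ((∑ x' : α X, count D X x' Z z : ℕ) : ℝ)))
    - 1 / 2 * Real.log N * dim α X Z

/-- The BIC score of a graph: the sum of the scores of the nodes given their parents. -/
noncomputable def BIC [Fintype V] {N : ℕ} (D : Fin N → ∀ i, α i) (G : Digraph V) : ℝ :=
  ∑ X : V, localBIC D X (parents G X)

/-- `G` is a DAG whose BIC score over `D` is maximal among all the DAGs on the same nodes. -/
def MaximizesBIC [Fintype V] {N : ℕ} (D : Fin N → ∀ i, α i) (G : Digraph V) : Prop :=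
  IsDAG G ∧ ∀ H : Digraph V, IsDAG H → BIC D H ≤ BIC D G

end Score

section Projection

variable {V : Type*} {α : V → Type*}

/-- The projection of a dataset over the set `O` of variables. -/
def project (O : Finset V) {N : ℕ} (D : Fin N → ∀ i, α i) : Fin N → ∀ i : O, α i :=
  fun k i => D k i

/-- The marginal over the set `O` of variables. -/
noncomputable def marginal [∀ i, MeasurableSpace (α i)] (O : Finset V)
    (P : Measure (∀ i, α i)) : Measure (∀ i : O, α i) :=
  P.map fun x (i : O) => x i

end Projection

end LatentBN

/-! Only comparisons between two nested parent sets of a single node are needed.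

Analysis. For Z ⊆ Z', the gain in log-likelihood from Z to Z' is N times the divergence of the
empirical table from the table `expected`, in which X and Z' \ Z are independent given Z
(`logLik_sub_logLik_merge`). If X depends on Z' \ Z given Z under P, this divergence has a positive
limit, so the gain is linear in N and beats the penalty of order log N. Under conditional
independence the divergence is at most a chi-square statistic (`logLik_sub_logLik_merge_le`). Almost
surely the frequencies converge at rate o(√(log N / N)) (`ae_isLittleO_sum`, from a maximal
Hoeffding inequality and Borel–Cantelli), so the gain is o(log N) and the penalty wins. There are
finitely many triples (X, Z, Z'), so eventually every nested comparison is decided by P.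

Graphs. Let G be a maximizer. A parent-closed set S that omits w contains no descendant of w, so S
can replace the parents of w without creating a cycle. Maximality then forces w to be independent of
S \ Pa(w) given Pa(w) whenever Pa(w) ⊆ S. This ordered Markov property gives the factorization along
G, and hence the global Markov property (`IsOrderedMarkov.isIMap`). If a proper subgraph H were
still an I-map, some w would lose parents, and d-separation in H would make the lost ones
uninformative. The smaller parent set would then improve the score of G. -/

namespace LatentBN

/-! ### Unblocked trails, d-separation and acyclicity -/

section Trails

variable {V : Type*} {G : Digraph V} {Z : Set V}

theorem mem_parents [Fintype V] {u v : V} :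
    u ∈ parents G v ↔ G.Adj u v := by
  simp [parents]

/-- A node with an unblocked trail from `X`, whose last arc, if there is one, satisfies `L`
(applied to the last but one node). -/
def Reach (G : Digraph V) (Z : Set V) (X v : V) (L : V → Prop) : Prop :=
  ∃ n c, IsTrail G n c X v ∧ ¬ IsBlocked G Z n c ∧ ∀ m, n = m + 1 → L (c m)

theorem Reach.refl (X : V) (L : V → Prop) : Reach G Z X X L :=
  ⟨0, fun _ => X, ⟨rfl, rfl, fun i hi => absurd hi (Nat.not_lt_zero i)⟩,
    fun ⟨i, hi, _⟩ => by omega, fun m hm => by omega⟩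

theorem Reach.mono {X v : V} {L L' : V → Prop} (h : Reach G Z X v L) (hL : ∀ u, L u → L' u) :
    Reach G Z X v L' := by
  obtain ⟨n, c, h1, h2, h3⟩ := h
  exact ⟨n, c, h1, h2, fun m hm => hL _ (h3 m hm)⟩

/-- Extending an unblocked trail by one arc. -/
theorem Reach.extend {X u v : V} {L : V → Prop} (h : Reach G Z X u L)
    (hadj : G.Adj u v ∨ G.Adj v u)
    (hcol : ∀ t, L t → IsCollider G t u v → u ∈ Z ∨ ∃ w, IsDescendant G u w ∧ w ∈ Z)
    (hnon : ∀ t, L t → ¬ IsCollider G t u v → u ∉ Z) :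
    Reach G Z X v (fun t => t = u) := by
  obtain ⟨n, c, ⟨h0, hn, hstep⟩, hblk, hL⟩ := h
  -- Trails may revisit nodes, so appending an arc needs no freshness check; only the old endpoint u
  -- becomes a new interior node.
  refine ⟨n + 1, fun i => if i ≤ n then c i else v, ⟨by simpa using h0, by simp, ?_⟩, ?_, ?_⟩
  · intro i hi
    rcases Nat.lt_succ_iff_lt_or_eq.1 hi with hi | rfl
    · simpa [hi.le, Nat.succ_le_of_lt hi] using hstep i hi
    · simpa [hn] using hadj
  · rintro ⟨i, hi, hb⟩
    rcases Nat.lt_succ_iff_lt_or_eq.1 hi with hi' | rfl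
    · refine hblk ⟨i, hi', ?_⟩
      have h1 : i ≤ n := by omega
      have h2 : i + 1 ≤ n := by omega
      have h3 : i + 2 ≤ n := by omega
      simpa [h1, h2, h3] using hb
    · have h1 : i ≤ i + 1 := by omega
      have h3 : ¬ i + 2 ≤ i + 1 := by omega
      simp only [h1, h3, if_true, if_false, le_refl, hn] at hb
      rcases hb with ⟨hc, hz, hd⟩ | ⟨hc, hz⟩
      · rcases hcol _ (hL i rfl) hc with h | ⟨w, hw, hwZ⟩
        · exact hz h
        · exact hd w hw hwZ
      · exact hnon _ (hL i rfl) hc hz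
  · intro m hm
    obtain rfl : n = m := by omega
    simpa using hn

theorem IsDAG.not_adj_symm (hG : IsDAG G) {u v : V} (h : G.Adj u v) : ¬ G.Adj v u :=
  fun h' => hG u ((Relation.TransGen.single h).tail h')

theorem IsDAG.mono {H : Digraph V} (hG : IsDAG G) (h : H ≤ G) : IsDAG H :=
  fun v hv => hG v (Relation.TransGen.mono (fun _ _ hab => h hab) _ _ hv)

/-- An unblocked trail extends along a directed path outside `Z`. -/
theorem Reach.extend_down (hG : IsDAG G) {X w b : V} (h : Reach G Z X w fun _ => True)
    (hwb : Relation.ReflTransGen G.Adj w b)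
    (hZ : ∀ x, Relation.ReflTransGen G.Adj w x → x ∉ Z) :
    Reach G Z X b fun _ => True := by
  induction hwb with
  | refl => exact h
  | tail hab hbc ih =>
    refine (ih.extend (Or.inl hbc) ?_ ?_).mono fun _ _ => trivial
    · rintro t - ⟨-, hc⟩
      exact absurd hc (hG.not_adj_symm hbc)
    · intro t _ _
      exact hZ _ hab

/-- Going up a directed path outside `Z`. -/
theorem Reach.of_ancestor (hG : IsDAG G) {X w : V} (hwX : Relation.ReflTransGen G.Adj w X)
    (hZ : ∀ x, Relation.ReflTransGen G.Adj w x → x ∉ Z) :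
    Reach G Z X w (fun t => G.Adj w t) := by
  induction hwX using Relation.ReflTransGen.head_induction_on with
  | refl => exact Reach.refl _ _
  | @head a b hab hbX ih =>
    have ih := ih fun x hx => hZ x (hx.head hab)
    refine (ih.extend (Or.inr hab) ?_ ?_).mono (by rintro _ rfl; exact hab)
    · rintro t ht ⟨htb, -⟩
      exact absurd htb (hG.not_adj_symm ht)
    · intro t _ _
      exact hZ _ (Relation.ReflTransGen.single hab)

theorem DSep.not_reach {A B : Set V} (h : DSep G A B Z) {X Y : V} (hX : X ∈ A) (hY : Y ∈ B)
    (L : V → Prop) : ¬ Reach G Z X Y L := by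
  rintro ⟨n, c, hc, hb, -⟩
  exact hb (h X hX Y hY n c hc)

/-- The nodes with a directed path, possibly of length zero, to `S`. -/
def ancestors (G : Digraph V) (S : Set V) : Set V :=
  {v | ∃ w ∈ S, Relation.ReflTransGen G.Adj v w}

theorem subset_ancestors (S : Set V) : S ⊆ ancestors G S :=
  fun v hv => ⟨v, hv, .refl⟩

theorem ancestors_of_adj {S : Set V} {u v : V} (h : G.Adj u v) (hv : v ∈ ancestors G S) :
    u ∈ ancestors G S := by
  obtain ⟨w, hw, hvw⟩ := hv
  exact ⟨w, hw, hvw.head h⟩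

/-- The nodes outside `Z` reached from `A` by an unblocked trail. -/
def reachSet (G : Digraph V) (A Z : Set V) : Set V :=
  {v | v ∉ Z ∧ ∃ X ∈ A, Reach G Z X v (fun _ => True)}

/-- From a reached node of the ancestral set, an unblocked trail goes on to each parent. -/
theorem DSep.parent_mem_reachSet (hG : IsDAG G) {A B : Set V} (h : DSep G A B Z)
    {w v : V} {L : V → Prop}
    (hw : w ∈ ancestors G (A ∪ B ∪ Z)) (hwZ : (∀ t, L t → G.Adj t w) ∨ w ∉ Z)
    (hr : ∃ X ∈ A, Reach G Z X w L) (hvw : G.Adj v w) (hv : v ∉ Z) :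
    v ∈ reachSet G A Z := by
  obtain ⟨X, hX, hr⟩ := hr
  refine ⟨hv, ?_⟩
  by_cases hanc : ∃ z ∈ Z, Relation.ReflTransGen G.Adj w z
  -- With a descendant in Z, or itself in Z, w is open as a collider; as a non-collider it is open
  -- because `hwZ` then puts it outside Z.
  · obtain ⟨z, hz, hwz⟩ := hanc
    refine ⟨X, hX, (hr.extend (Or.inr hvw) ?_ ?_).mono fun _ _ => trivial⟩
    · intro t _ _
      rcases Relation.reflTransGen_iff_eq_or_transGen.1 hwz with rfl | hwz
      · exact Or.inl hz
      · exact Or.inr ⟨z, hwz, hz⟩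
    · intro t ht hc
      rcases hwZ with hwZ | hwZ
      · exact absurd ⟨hwZ t ht, hvw⟩ hc
      · exact hwZ
  -- Now nothing below w is in Z. A directed path from w to A is climbed from its end, giving a new
  -- trail that passes w as a non-collider; a directed path from w to B would extend the given trail
  -- to B, against d-separation.
  · have hZ : ∀ x, Relation.ReflTransGen G.Adj w x → x ∉ Z := fun x hx hxZ => hanc ⟨x, hxZ, hx⟩
    obtain ⟨y, (hy | hy) | hy, hwy⟩ := hw
    · refine ⟨y, hy, ((Reach.of_ancestor hG hwy hZ).extend (Or.inr hvw) ?_ ?_).mono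
        fun _ _ => trivial⟩
      · rintro t ht ⟨htw, -⟩
        exact absurd htw (hG.not_adj_symm ht)
      · intro t _ _
        exact hZ w .refl
    · exact absurd ((hr.mono fun _ _ => trivial).extend_down hG hwy hZ) (h.not_reach hX hy _)
    · exact absurd hy (hZ y hwy)

/-- Within the ancestral set, a family meeting the reached set lies in it up to `Z`. -/
theorem DSep.family_mem_reachSet (hG : IsDAG G) {A B : Set V} (h : DSep G A B Z)
    {w u v : V} (hw : w ∈ ancestors G (A ∪ B ∪ Z))
    (hu : u = w ∨ G.Adj u w) (hv : v = w ∨ G.Adj v w) (hur : u ∈ reachSet G A Z) (hvZ : v ∉ Z) :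
    v ∈ reachSet G A Z := by
  obtain ⟨huZ, X, hX, hr⟩ := hur
  rcases hu with rfl | hu
  · rcases hv with rfl | hv
    · exact ⟨hvZ, X, hX, hr⟩
    · exact h.parent_mem_reachSet hG hw (Or.inr huZ) ⟨X, hX, hr⟩ hv hvZ
  · have hr' : Reach G Z X w (fun t => t = u) := by
      refine hr.extend (Or.inl hu) ?_ fun _ _ _ => huZ
      rintro t - ⟨-, hc⟩
      exact absurd hc (hG.not_adj_symm hu)
    rcases hv with rfl | hv
    · exact ⟨hvZ, X, hX, hr'.mono fun _ _ => trivial⟩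
    · exact h.parent_mem_reachSet hG hw (Or.inl (by rintro _ rfl; exact hu)) ⟨X, hX, hr'⟩ hv hvZ

/-- A node is `d`-separated from its nondescendants by its parents. -/
theorem IsDAG.dSep_parents (hG : IsDAG G) (w : V) (B : Set V)
    (hB : ∀ b ∈ B, b ≠ w ∧ ¬ IsDescendant G w b ∧ ¬ G.Adj b w) :
    DSep G {w} B {u | G.Adj u w} := by
  rintro X rfl Y hY n c ⟨h0, hn, hstep⟩
  obtain ⟨hne, hnd, hna⟩ := hB Y hY
  by_contra hblk
  -- An unblocked trail from w must run along the arrows: a first arc into w is stopped at a parent,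
  -- and the first reversal is a collider at a descendant of w, which cannot have a descendant among
  -- the parents of w.
  have key : ∀ m, m + 1 ≤ n → G.Adj (c m) (c (m + 1)) ∧ IsDescendant G X (c (m + 1)) := by
    intro m
    induction m with
    | zero =>
      intro hm
      rcases hstep 0 (by omega) with h | h
      · exact ⟨h, .single (h0 ▸ h)⟩
      · exfalso
        rw [h0] at h
        rcases Nat.eq_or_lt_of_le hm with h1 | h1
        · rw [← hn, ← h1] at hna
          exact hna h
        · refine hblk ⟨0, h1, Or.inr ⟨fun hc => ?_, h⟩⟩
          have := hc.1
          rw [h0] at this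
          exact hG.not_adj_symm h this
    | succ m ih =>
      intro hm
      obtain ⟨h1, h2⟩ := ih (by omega)
      rcases hstep (m + 1) (by omega) with h | h
      · exact ⟨h, h2.tail h⟩
      · exfalso
        refine hblk ⟨m, by omega, Or.inl ⟨⟨h1, h⟩, fun hz => ?_, fun x hx hz => ?_⟩⟩
        · exact hG X (h2.tail hz)
        · exact hG X ((h2.trans hx).tail hz)
  cases n with
  | zero => exact hne (hn.symm.trans h0)
  | succ n => exact hnd (hn ▸ (key n le_rfl).2)

/-- The graph `G` with the parents of `w` replaced by `S`. -/
def setParents (G : Digraph V) (w : V) (S : Set V) : Digraph V where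
  Adj u v := (v = w ∧ u ∈ S) ∨ (v ≠ w ∧ G.Adj u v)

/-- A new cycle either uses old arcs only or passes through w. From w the new graph reaches only old
descendants of w, none of which lies in S, so no path returns to w. -/
theorem IsDAG.setParents (hG : IsDAG G) {w : V} {S : Set V}
    (hS : ∀ s ∈ S, s ≠ w ∧ ¬ IsDescendant G w s) : IsDAG (setParents G w S) := by
  have hdesc : ∀ x y, Relation.TransGen (LatentBN.setParents G w S).Adj x y →
      IsDescendant G x y ∨ Relation.ReflTransGen (LatentBN.setParents G w S).Adj x w ∧
        Relation.ReflTransGen (LatentBN.setParents G w S).Adj w y := by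
    intro x y hxy
    induction hxy with
    | single h =>
      rcases h with ⟨rfl, h⟩ | ⟨-, h⟩
      · exact Or.inr ⟨.single (Or.inl ⟨rfl, h⟩), .refl⟩
      · exact Or.inl (.single h)
    | tail hab hbc ih =>
      rcases ih with ih | ih
      · rcases hbc with ⟨rfl, h⟩ | ⟨-, h⟩
        · exact Or.inr ⟨hab.to_reflTransGen.tail (Or.inl ⟨rfl, h⟩), .refl⟩
        · exact Or.inl (ih.tail h)
      · exact Or.inr ⟨ih.1, ih.2.tail hbc⟩
  have hw : ∀ y, Relation.TransGen (LatentBN.setParents G w S).Adj w y →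
      y ≠ w ∧ IsDescendant G w y := by
    intro y hy
    induction hy with
    | single h =>
      rcases h with ⟨rfl, h⟩ | ⟨h1, h⟩
      · exact absurd rfl (hS _ h).1
      · exact ⟨h1, .single h⟩
    | tail hab hbc ih =>
      rcases hbc with ⟨rfl, h⟩ | ⟨h1, h⟩
      · exact absurd ih.2 (hS _ h).2
      · exact ⟨h1, ih.2.tail h⟩
  intro v hv
  rcases hdesc v v hv with h | ⟨h1, h2⟩
  · exact hG v h
  · exact (hw w ((hv.trans_right h2).trans_left h1)).1 rfl

end Trails

/-! ### Factorization and the global Markov property -/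

section Markov

variable {V : Type*} {α : V → Type*} {G : Digraph V}

theorem agree_anti {S T : Set V} (h : S ⊆ T) (x : ∀ i, α i) : agree T x ⊆ agree S x :=
  fun _ hy i hi => hy i (h hi)

theorem mem_agree_comm {S : Set V} {x y : ∀ i, α i} : y ∈ agree S x ↔ x ∈ agree S y :=
  ⟨fun h i hi => (h i hi).symm, fun h i hi => (h i hi).symm⟩

theorem agree_congr {S : Set V} {x y : ∀ i, α i} (h : y ∈ agree S x) : agree S y = agree S x := by
  ext z
  exact forall₂_congr fun i hi => by rw [h i hi]

theorem agree_empty (x : ∀ i, α i) : agree (∅ : Set V) x = Set.univ := by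
  ext z
  simp [agree]

-- Overwriting the coordinates in S maps one class injectively into the other. The common size is
-- the multiplicity in `sum_real_agree`.
open Classical in
theorem card_agree_eq [Fintype V] [∀ i, Fintype (α i)] (S : Set V) (x y : ∀ i, α i) :
    (Finset.univ.filter (· ∈ agree S x)).card = (Finset.univ.filter (· ∈ agree S y)).card := by
  have key : ∀ x y : ∀ i, α i, (Finset.univ.filter (· ∈ agree S x)).card ≤
      (Finset.univ.filter (· ∈ agree S y)).card := by
    intro x y
    refine Finset.card_le_card_of_injOn (fun z => S.piecewise y z) ?_ ?_
    · intro z _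
      simp only [Finset.coe_filter, Finset.mem_univ, true_and, Set.mem_ofPred_eq]
      intro i hi
      simp [hi]
    · intro z hz z' hz' he
      simp only [Finset.coe_filter, Finset.mem_univ, true_and, Set.mem_ofPred_eq] at hz hz'
      funext i
      by_cases hi : i ∈ S
      · rw [hz i hi, hz' i hi]
      · simpa [hi] using congrFun he i
  exact le_antisymm (key x y) (key y x)

variable [∀ i, MeasurableSpace (α i)]

/-- The ordered Markov property: given its parents, a node is independent of every parent-closed
set which contains the parents and does not contain the node. -/
def IsOrderedMarkov (G : Digraph V) (P : Measure (∀ i, α i)) : Prop :=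
  ∀ (S : Set V) (w : V), w ∉ S → (∀ u v, G.Adj u v → v ∈ S → u ∈ S) →
    {u | G.Adj u w} ⊆ S → CondIndep P {w} (S \ {u | G.Adj u w}) {u | G.Adj u w}

/-- The conditional probability of the value of `i` given the values of its parents. -/
noncomputable def condProb (G : Digraph V) (P : Measure (∀ i, α i)) (i : V) (x : ∀ i, α i) : ℝ :=
  P.real (agree (insert i {u | G.Adj u i}) x) / P.real (agree {u | G.Adj u i} x)

theorem condProb_congr {P : Measure (∀ i, α i)} {i : V} {x y : ∀ i, α i}
    (h : y ∈ agree (insert i {u | G.Adj u i}) x) : condProb G P i y = condProb G P i x := by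
  rw [condProb, condProb, agree_congr h, agree_congr (agree_anti (Set.subset_insert _ _) _ h)]

/-- A nonempty set of nodes of a finite DAG has a node without children in the set. -/
theorem IsDAG.exists_sink [Finite V] (hG : IsDAG G) {S : Set V} (hS : S.Nonempty) :
    ∃ w ∈ S, ∀ v ∈ S, ¬ G.Adj w v := by
  let r : V → V → Prop := fun a b => Relation.TransGen G.Adj b a
  have : IsTrans V r := ⟨fun a b c h1 h2 => h2.trans h1⟩
  have : Std.Irrefl r := ⟨fun a h => hG a h⟩
  obtain ⟨w, hw, hmin⟩ := (Finite.wellFounded_of_trans_of_irrefl r).has_min S hS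
  exact ⟨w, hw, fun v hv h => hmin v hv (.single h)⟩

/-- The marginal over a parent-closed set is the product of the conditional probabilities. -/
theorem IsOrderedMarkov.real_agree_eq_prod [Finite V] (hG : IsDAG G) {P : Measure (∀ i, α i)}
    [IsProbabilityMeasure P] (h : IsOrderedMarkov G P) (x : ∀ i, α i) (S : Finset V)
    (hS : ∀ u v, G.Adj u v → v ∈ S → u ∈ S) :
    P.real (agree (S : Set V) x) = ∏ i ∈ S, condProb G P i x := by
  classical
  induction hn : S.card generalizing S with
  | zero =>
    obtain rfl := Finset.card_eq_zero.1 hn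
    simp [agree_empty]
  | succ n ih =>
    obtain ⟨w, hw, hsink⟩ := hG.exists_sink (S := (S : Set V))
      (Finset.card_pos.1 (by omega))
    have hw : w ∈ S := hw
    have hcl : ∀ u v, G.Adj u v → v ∈ S.erase w → u ∈ S.erase w := by
      intro u v huv hv
      refine Finset.mem_erase.2 ⟨?_, hS u v huv (Finset.mem_of_mem_erase hv)⟩
      rintro rfl
      exact hsink v (Finset.mem_of_mem_erase hv) huv
    have hpa : {u | G.Adj u w} ⊆ (S.erase w : Set V) := by
      intro u hu
      refine Finset.mem_coe.2 (Finset.mem_erase.2 ⟨?_, hS u w hu hw⟩)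
      rintro rfl
      exact hG u (.single hu)
    have hih := ih (S.erase w) hcl (by rw [Finset.card_erase_of_mem hw]; omega)
    have hci := h (S.erase w : Set V) w (by simp) hcl hpa x
    have e1 : ({w} ∪ ((S.erase w : Set V) \ {u | G.Adj u w}) ∪ {u | G.Adj u w} : Set V) = S := by
      rw [Set.union_assoc, Set.sdiff_union_of_subset hpa, ← Finset.coe_singleton,
        ← Finset.coe_union, Finset.singleton_union, Finset.insert_erase hw]
    rw [e1, Set.sdiff_union_of_subset hpa, Set.singleton_union] at hci
    rw [← Finset.mul_prod_erase S _ hw, ← hih, condProb]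
    -- If the parents' values have probability zero, the quotient in `condProb` is 0 by convention,
    -- and so is the marginal on the left.
    rcases eq_or_ne (P.real (agree {u | G.Adj u w} x)) 0 with h0 | h0
    · have hle : P.real (agree (S : Set V) x) ≤ P.real (agree {u | G.Adj u w} x) :=
        measureReal_mono (agree_anti (hpa.trans (by simp)) x)
      rw [h0, div_zero, zero_mul]
      exact le_antisymm (hle.trans_eq h0) measureReal_nonneg
    · rw [div_mul_eq_mul_div, eq_div_iff h0, hci]

open Classical in
theorem real_eq_sum {Ω₀ : Type*} [Fintype Ω₀] [MeasurableSpace Ω₀] [MeasurableSingletonClass Ω₀]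
    (P : Measure Ω₀) [IsFiniteMeasure P] (C : Set Ω₀) :
    P.real C = ∑ y, if y ∈ C then P.real {y} else 0 := by
  rw [← Finset.sum_filter, sum_measureReal_singleton]
  congr 1
  ext y
  simp

variable [Fintype V] [∀ i, Fintype (α i)] [∀ i, MeasurableSingletonClass (α i)]

open Classical in
/-- Summing a marginal over the assignments with given values on a smaller set. -/
theorem sum_real_agree (P : Measure (∀ i, α i)) [IsFiniteMeasure P] {T S : Set V} (hTS : T ⊆ S)
    (x : ∀ i, α i) :
    ∑ y, (if y ∈ agree T x then P.real (agree S y) else 0) =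
      (Finset.univ.filter (· ∈ agree S x)).card * P.real (agree T x) := by
  -- Double counting: a point z of `agree T x` is counted once for each y agreeing with z on S, a
  -- number independent of z.
  have h1 : ∀ y, (if y ∈ agree T x then P.real (agree S y) else 0) =
      ∑ z, if z ∈ agree T x then (if y ∈ agree S z then P.real {z} else 0) else 0 := by
    intro y
    rw [real_eq_sum P (agree S y)]
    split_ifs with hy
    · refine Finset.sum_congr rfl fun z _ => ?_
      by_cases hz : z ∈ agree S y
      · have : z ∈ agree T x := by
          rw [← agree_congr hy]
          exact agree_anti hTS _ hz
        simp [hz, this, mem_agree_comm.1 hz]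
      · simp [hz, mt mem_agree_comm.1 hz]
    · refine (Finset.sum_eq_zero fun z _ => ?_).symm
      split_ifs with hz hyz
      · exact absurd ((agree_congr hz) ▸ agree_anti hTS _ hyz) hy
      · rfl
      · rfl
  rw [Finset.sum_congr rfl fun y _ => h1 y, Finset.sum_comm, real_eq_sum P (agree T x),
    Finset.mul_sum]
  refine Finset.sum_congr rfl fun z _ => ?_
  split_ifs with hz
  · rw [← Finset.sum_filter, Finset.sum_const, nsmul_eq_mul, card_agree_eq S z x]
  · simp

/-- A probability with the ordered Markov property has the global Markov property. -/
theorem IsOrderedMarkov.isIMap (hG : IsDAG G) {P : Measure (∀ i, α i)} [IsProbabilityMeasure P]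
    (h : IsOrderedMarkov G P) : IsIMap G P := by
  classical
  intro A B Z hAB hAZ hBZ hsep x
  set An := ancestors G (A ∪ B ∪ Z)
  set R := reachSet G A Z
  have hAR : A ⊆ R := fun a ha => ⟨Set.disjoint_left.1 hAZ ha, a, ha, Reach.refl _ _⟩
  have hBR : Disjoint B R := Set.disjoint_left.2 fun b hb ⟨_, X, hX, hr⟩ => hsep.not_reach hX hb _ hr
  have hZR : Disjoint Z R := Set.disjoint_left.2 fun b hb hr => hr.1 hb
  -- A family in the ancestral set that meets R lies in R ∪ Z; the others avoid R. Hence the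
  -- marginal over An splits as f · g, with f a function of R ∪ Z and g a function of the complement
  -- of R, while A ⊆ R and B, Z avoid R.
  let meets : V → Prop := fun i => ∃ u, (u = i ∨ G.Adj u i) ∧ u ∈ R
  let f : (∀ i, α i) → ℝ := fun y => ∏ i ∈ An.toFinset.filter meets, condProb G P i y
  let g : (∀ i, α i) → ℝ := fun y => ∏ i ∈ An.toFinset.filter (¬ meets ·), condProb G P i y
  have hfg : ∀ y, P.real (agree An y) = f y * g y := by
    intro y
    rw [Finset.prod_filter_mul_prod_filter_not,
      ← h.real_agree_eq_prod hG y An.toFinset, Set.coe_toFinset]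
    intro u v huv hv
    rw [Set.mem_toFinset] at hv ⊢
    exact ancestors_of_adj huv hv
  have hf : ∀ y y', y ∈ agree (R ∪ Z) y' → f y = f y' := by
    intro y y' hy
    refine Finset.prod_congr rfl fun i hi => condProb_congr fun j hj => hy j ?_
    obtain ⟨hi, u, hu, huR⟩ := Finset.mem_filter.1 hi
    by_cases hjZ : j ∈ Z
    · exact Or.inr hjZ
    · exact Or.inl (hsep.family_mem_reachSet hG (Set.mem_toFinset.1 hi) hu hj huR hjZ)
  have hg : ∀ y y', y ∈ agree Rᶜ y' → g y = g y' := by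
    intro y y' hy
    refine Finset.prod_congr rfl fun i hi => condProb_congr fun j hj => hy j fun hjR => ?_
    exact (Finset.mem_filter.1 hi).2 ⟨j, hj, hjR⟩
  -- Sums over full assignments overcount each marginal by the same factor K, which cancels.
  set K : ℝ := ((Finset.univ.filter (· ∈ agree An x)).card : ℝ) with hK
  have hK0 : K ≠ 0 := by
    rw [hK, Nat.cast_ne_zero, ← Nat.pos_iff_ne_zero, Finset.card_pos]
    exact ⟨x, Finset.mem_filter.2 ⟨Finset.mem_univ _, fun _ _ => rfl⟩⟩
  have hsum : ∀ T : Set V, T ⊆ A ∪ B ∪ Z →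
      K * P.real (agree T x) = ∑ y, if y ∈ agree T x then f y * g y else 0 := by
    intro T hT
    rw [hK, ← sum_real_agree P (S := An) (hT.trans (subset_ancestors _)) x]
    exact Finset.sum_congr rfl fun y _ => by rw [hfg]
  -- exchanging the values outside `R` of two assignments
  let e : (∀ i, α i) × (∀ i, α i) → (∀ i, α i) × (∀ i, α i) :=
    fun p => (R.piecewise p.1 p.2, R.piecewise p.2 p.1)
  have he : Function.Involutive e := by
    rintro ⟨y, y'⟩
    refine Prod.ext ?_ ?_ <;> funext i <;> by_cases hi : i ∈ R <;> simp [e, hi]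
  refine mul_left_cancel₀ (mul_ne_zero hK0 hK0) ?_
  rw [mul_mul_mul_comm, mul_mul_mul_comm K K, hsum _ le_rfl, hsum Z Set.subset_union_right,
    hsum (A ∪ Z) (Set.union_subset_union_left _ Set.subset_union_left),
    hsum (B ∪ Z) (Set.union_subset_union_left _ Set.subset_union_right),
    Finset.sum_mul_sum, Finset.sum_mul_sum, ← Finset.sum_product', ← Finset.sum_product',
    Finset.univ_product_univ]
  refine Fintype.sum_equiv he.toPerm _ _ ?_
  rintro ⟨y, y'⟩
  change (if y ∈ agree (A ∪ B ∪ Z) x then f y * g y else 0) *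
      (if y' ∈ agree Z x then f y' * g y' else 0) =
    (if R.piecewise y y' ∈ agree (A ∪ Z) x then
        f (R.piecewise y y') * g (R.piecewise y y') else 0) *
      (if R.piecewise y' y ∈ agree (B ∪ Z) x then
        f (R.piecewise y' y) * g (R.piecewise y' y) else 0)
  have hiff : (y ∈ agree (A ∪ B ∪ Z) x ∧ y' ∈ agree Z x) ↔
      (R.piecewise y y' ∈ agree (A ∪ Z) x ∧ R.piecewise y' y ∈ agree (B ∪ Z) x) := by
    have hA : ∀ i ∈ A, i ∈ R := fun i hi => hAR hi
    have hB : ∀ i ∈ B, i ∉ R := fun i hi => Set.disjoint_left.1 hBR hi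
    have hZ : ∀ i ∈ Z, i ∉ R := fun i hi => Set.disjoint_left.1 hZR hi
    constructor
    · rintro ⟨h1, h2⟩
      constructor
      · rintro i (hi | hi)
        · simpa [hA i hi] using h1 i (Or.inl (Or.inl hi))
        · simpa [hZ i hi] using h2 i hi
      · rintro i (hi | hi)
        · simpa [hB i hi] using h1 i (Or.inl (Or.inr hi))
        · simpa [hZ i hi] using h1 i (Or.inr hi)
    · rintro ⟨h1, h2⟩
      constructor
      · rintro i ((hi | hi) | hi)
        · simpa [hA i hi] using h1 i (Or.inl hi)
        · simpa [hB i hi] using h2 i (Or.inl hi)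
        · simpa [hZ i hi] using h2 i (Or.inr hi)
      · intro i hi
        simpa [hZ i hi] using h1 i (Or.inr hi)
  rw [ite_zero_mul_ite_zero, ite_zero_mul_ite_zero]
  refine if_ctx_congr hiff (fun hc => ?_) fun _ => rfl
  obtain ⟨h1, h2⟩ := hiff.2 hc
  -- f also reads Z, which is exchanged, but both assignments equal x there.
  have hyZ : ∀ i ∈ Z, y i = y' i := fun i hi => (h1 i (Or.inr hi)).trans (h2 i hi).symm
  have hp1 : f (R.piecewise y y') = f y := by
    refine hf _ _ fun i hi => ?_
    by_cases hiR : i ∈ R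
    · simp [hiR]
    · simpa [hiR] using (hyZ i (hi.resolve_left hiR)).symm
  have hp2 : f (R.piecewise y' y) = f y' := by
    refine hf _ _ fun i hi => ?_
    by_cases hiR : i ∈ R
    · simp [hiR]
    · simpa [hiR] using hyZ i (hi.resolve_left hiR)
  have hp3 : g (R.piecewise y y') = g y' := hg _ _ fun i hi => by
    simp [show i ∉ R from hi]
  have hp4 : g (R.piecewise y' y) = g y := hg _ _ fun i hi => by
    simp [show i ∉ R from hi]
  rw [hp1, hp2, hp3, hp4]
  ring

end Markov

/-! ### Log-likelihoods of contingency tables -/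

section Tables

open Asymptotics Topology

/-- This is 1 - 1/t ≤ log t at t = a / b. Summed over tables of equal mass it gives nonnegativity of
the divergence. -/
theorem sub_le_mul_log_div {a b : ℝ} (ha : 0 ≤ a) (hb : 0 ≤ b) (h : b = 0 → a = 0) :
    a - b ≤ a * Real.log (a / b) := by
  rcases ha.eq_or_lt with rfl | ha
  · simpa using hb
  have hb : 0 < b := hb.lt_of_ne fun h0 => ha.ne' (h h0.symm)
  have := Real.one_sub_inv_le_log_of_pos (div_pos ha hb)
  calc a - b = a * (1 - (a / b)⁻¹) := by field_simp
    _ ≤ _ := mul_le_mul_of_nonneg_left this ha.le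

/-- log t < t - 1 is strict away from t = 1. -/
theorem eq_of_mul_log_div_eq_sub {a b : ℝ} (ha : 0 ≤ a) (hb : 0 ≤ b) (h : b = 0 → a = 0)
    (he : a * Real.log (a / b) = a - b) : a = b := by
  rcases ha.eq_or_lt with rfl | ha
  · simp at he
    exact he.symm
  have hb : 0 < b := hb.lt_of_ne fun h0 => ha.ne' (h h0.symm)
  by_contra hne
  have h1 : b / a ≠ 1 := fun h1 => hne ((div_eq_one_iff_eq ha.ne').1 h1).symm
  have h2 := Real.log_lt_sub_one_of_pos (div_pos hb ha) h1
  have h3 : Real.log (a / b) = - Real.log (b / a) := by rw [← Real.log_inv, inv_div]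
  have h4 : a * Real.log (b / a) < a * (b / a - 1) := mul_lt_mul_of_pos_left h2 ha
  have h5 : a * (b / a - 1) = b - a := by field_simp
  rw [h3] at he
  linarith

/-- From log t ≤ t - 1; the linear terms cancel in the sum, leaving chi-square. -/
theorem mul_log_div_le {a b : ℝ} (ha : 0 ≤ a) (hb : 0 ≤ b) (h : b = 0 → a = 0) :
    a * Real.log (a / b) ≤ (a - b) ^ 2 / b + (a - b) := by
  rcases ha.eq_or_lt with rfl | ha
  · rcases hb.eq_or_lt with rfl | hb
    · simp
    · have : (0 - b) ^ 2 / b + (0 - b) = 0 := by field_simp; ring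
      rw [this, zero_mul]
  have hb : 0 < b := hb.lt_of_ne fun h0 => ha.ne' (h h0.symm)
  have := Real.log_le_sub_one_of_pos (div_pos ha hb)
  calc a * Real.log (a / b) ≤ a * (a / b - 1) := mul_le_mul_of_nonneg_left this ha.le
    _ = _ := by field_simp; ring

variable {I J K : Type*} {π : K → J} {u p : I → K → ℝ}

theorem le_colSum [Fintype I] (hu : ∀ i k, 0 ≤ u i k) (i : I) (k : K) : u i k ≤ ∑ i', u i' k :=
  Finset.single_le_sum (f := fun i => u i k) (fun i _ => hu i k) (Finset.mem_univ i)

variable [Fintype K]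

open Classical in
/-- The table obtained by merging the columns with the same image under `π`. -/
noncomputable def merge (π : K → J) (u : I → K → ℝ) (i : I) (j : J) : ℝ :=
  ∑ k with π k = j, u i k

theorem merge_nonneg (hu : ∀ i k, 0 ≤ u i k) (i : I) (j : J) : 0 ≤ merge π u i j :=
  Finset.sum_nonneg fun k _ => hu i k

theorem le_merge (hu : ∀ i k, 0 ≤ u i k) (i : I) (k : K) : u i k ≤ merge π u i (π k) := by
  classical
  exact Finset.single_le_sum (f := fun k => u i k) (fun k _ => hu i k) (by simp)

theorem tendsto_merge {v : ℕ → I → K → ℝ}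
    (hlim : ∀ i k, Tendsto (fun N => v N i k) atTop (𝓝 (p i k))) (i : I) (j : J) :
    Tendsto (fun N => merge π (v N) i j) atTop (𝓝 (merge π p i j)) :=
  tendsto_finsetSum _ fun k _ => hlim i k

variable [Fintype I]

/-- The maximal log-likelihood of a contingency table of the row variable given the column
variable. -/
noncomputable def logLik (u : I → K → ℝ) : ℝ :=
  ∑ i, ∑ k, u i k * Real.log (u i k / ∑ i', u i' k)

/-- The table in which rows and columns are independent given the merged column, with the same
row sums in each merged column and the same column sums as `u`. -/
noncomputable def expected (π : K → J) (u : I → K → ℝ) (i : I) (k : K) : ℝ :=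
  (∑ i', u i' k) * merge π u i (π k) / ∑ i', merge π u i' (π k)

theorem logLik_smul (c : ℝ) (u : I → K → ℝ) : logLik (c • u) = c * logLik u := by
  rcases eq_or_ne c 0 with rfl | hc
  · simp [logLik]
  simp only [logLik, Finset.mul_sum, Pi.smul_apply, smul_eq_mul]
  refine Finset.sum_congr rfl fun i _ => Finset.sum_congr rfl fun k _ => ?_
  rw [← Finset.mul_sum, mul_div_mul_left _ _ hc, mul_assoc]

theorem expected_nonneg (hu : ∀ i k, 0 ≤ u i k) (i : I) (k : K) : 0 ≤ expected π u i k :=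
  div_nonneg (mul_nonneg (Finset.sum_nonneg fun i _ => hu i k) (merge_nonneg hu _ _))
    (Finset.sum_nonneg fun _ _ => merge_nonneg hu _ _)

theorem expected_pos (hu : ∀ i k, 0 ≤ u i k) {i : I} {k : K} (h : 0 < u i k) :
    0 < expected π u i k := by
  have h1 : 0 < merge π u i (π k) := h.trans_le (le_merge hu i k)
  exact div_pos (mul_pos (h.trans_le (le_colSum hu i k)) h1)
    (h1.trans_le (le_colSum (merge_nonneg hu) i (π k)))

theorem eq_zero_of_expected_eq_zero (hu : ∀ i k, 0 ≤ u i k) {i : I} {k : K}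
    (h : expected π u i k = 0) : u i k = 0 := by
  by_contra h0
  exact (expected_pos hu ((hu i k).lt_of_ne (Ne.symm h0))).ne' h

theorem sum_expected (hu : ∀ i k, 0 ≤ u i k) :
    ∑ i, ∑ k, expected π u i k = ∑ i, ∑ k, u i k := by
  rw [Finset.sum_comm, Finset.sum_comm (f := u)]
  refine Finset.sum_congr rfl fun k _ => ?_
  simp only [expected]
  rw [← Finset.sum_div, ← Finset.mul_sum]
  rcases eq_or_ne (∑ i, merge π u i (π k)) 0 with h0 | h0
  · rw [h0, div_zero]
    symm
    refine Finset.sum_eq_zero fun i _ => le_antisymm ?_ (hu i k)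
    exact ((le_merge hu i k).trans (le_colSum (merge_nonneg hu) i (π k))).trans_eq h0
  · rw [mul_div_cancel_right₀ _ h0]

variable [Fintype J]

/-- The two conditional frequencies have quotient u / `expected`, so the difference is the
divergence of u from `expected`, a table of the same total mass. -/
theorem logLik_sub_logLik_merge (hu : ∀ i k, 0 ≤ u i k) :
    logLik u - logLik (merge π u) =
      ∑ i, ∑ k, u i k * Real.log (u i k / expected π u i k) := by
  classical
  have h1 : logLik (merge π u) = ∑ i, ∑ k, u i k *
      Real.log (merge π u i (π k) / ∑ i', merge π u i' (π k)) := by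
    refine Finset.sum_congr rfl fun i _ => ?_
    rw [← Finset.sum_fiberwise Finset.univ π]
    refine Finset.sum_congr rfl fun j _ => ?_
    conv_lhs => rw [merge, Finset.sum_mul]
    refine Finset.sum_congr (by congr) fun k hk => ?_
    rw [(Finset.mem_filter.1 hk).2]
    rfl
  rw [h1, logLik, ← Finset.sum_sub_distrib]
  refine Finset.sum_congr rfl fun i _ => ?_
  rw [← Finset.sum_sub_distrib]
  refine Finset.sum_congr rfl fun k _ => ?_
  rcases (hu i k).eq_or_lt with h0 | h0
  · simp [← h0]
  have ha := h0.trans_le (le_colSum hu i k)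
  have hb := h0.trans_le (le_merge (π := π) hu i k)
  have hc := hb.trans_le (le_colSum (merge_nonneg hu) i (π k))
  rw [← mul_sub, ← Real.log_div (div_pos h0 ha).ne' (div_pos hb hc).ne', expected]
  congr 2
  field_simp

theorem logLik_merge_le (hu : ∀ i k, 0 ≤ u i k) : logLik (merge π u) ≤ logLik u := by
  rw [← sub_nonneg, logLik_sub_logLik_merge hu]
  have h : ∑ i, ∑ k, (u i k - expected π u i k) = 0 := by
    simp only [Finset.sum_sub_distrib, sum_expected hu, sub_self]
  rw [← h]
  exact Finset.sum_le_sum fun i _ => Finset.sum_le_sum fun k _ =>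
    sub_le_mul_log_div (hu i k) (expected_nonneg hu i k) (eq_zero_of_expected_eq_zero hu)

/-- Merging columns leaves the log-likelihood unchanged only under conditional independence. -/
theorem eq_expected_of_logLik_le (hu : ∀ i k, 0 ≤ u i k)
    (h : logLik u ≤ logLik (merge π u)) (i : I) (k : K) : u i k = expected π u i k := by
  have h0 := sub_nonpos.2 h
  rw [logLik_sub_logLik_merge hu] at h0
  have hs : ∑ i, ∑ k, (u i k - expected π u i k) = 0 := by
    simp only [Finset.sum_sub_distrib, sum_expected hu, sub_self]
  have hle : ∀ i k, u i k - expected π u i k ≤ u i k * Real.log (u i k / expected π u i k) :=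
    fun i k =>
    sub_le_mul_log_div (hu i k) (expected_nonneg hu i k) (eq_zero_of_expected_eq_zero hu)
  have hle' : ∀ i, ∑ k, (u i k - expected π u i k) ≤
      ∑ k, u i k * Real.log (u i k / expected π u i k) :=
    fun i => Finset.sum_le_sum fun k _ => hle i k
  -- The termwise lower bounds sum to zero and the terms sum to at most zero, so every inequality is
  -- an equality.
  have heq := (Finset.sum_eq_sum_iff_of_le fun i _ => hle' i).1
    (le_antisymm (Finset.sum_le_sum fun i _ => hle' i) (h0.trans_eq hs.symm)) i (Finset.mem_univ i)
  have heq' := (Finset.sum_eq_sum_iff_of_le fun k _ => hle i k).1 heq k (Finset.mem_univ k)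
  exact eq_of_mul_log_div_eq_sub (hu i k) (expected_nonneg hu i k)
    (eq_zero_of_expected_eq_zero hu) heq'.symm

/-- The likelihood ratio is bounded by the chi-square statistic. -/
theorem logLik_sub_logLik_merge_le (hu : ∀ i k, 0 ≤ u i k) :
    logLik u - logLik (merge π u) ≤
      ∑ i, ∑ k, (u i k - expected π u i k) ^ 2 / expected π u i k := by
  have h : ∑ i, ∑ k, (u i k - expected π u i k) = 0 := by
    simp only [Finset.sum_sub_distrib, sum_expected hu, sub_self]
  rw [logLik_sub_logLik_merge hu,
    ← add_zero (∑ i, ∑ k, (u i k - expected π u i k) ^ 2 / expected π u i k), ← h,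
    ← Finset.sum_add_distrib]
  refine Finset.sum_le_sum fun i _ => ?_
  rw [← Finset.sum_add_distrib]
  exact Finset.sum_le_sum fun k _ =>
    mul_log_div_le (hu i k) (expected_nonneg hu i k) (eq_zero_of_expected_eq_zero hu)

/-- In this form only t log t occurs, which is continuous at 0 as well. -/
theorem logLik_eq (hu : ∀ i k, 0 ≤ u i k) :
    logLik u = ∑ i, ∑ k, u i k * Real.log (u i k) -
      ∑ k, (∑ i, u i k) * Real.log (∑ i, u i k) := by
  have h : ∑ k, (∑ i, u i k) * Real.log (∑ i, u i k) =
      ∑ i, ∑ k, u i k * Real.log (∑ i', u i' k) := by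
    rw [Finset.sum_comm]
    exact Finset.sum_congr rfl fun k _ => Finset.sum_mul _ _ _
  rw [h, logLik, ← Finset.sum_sub_distrib]
  refine Finset.sum_congr rfl fun i _ => ?_
  rw [← Finset.sum_sub_distrib]
  refine Finset.sum_congr rfl fun k _ => ?_
  rcases (hu i k).eq_or_lt with h0 | h0
  · simp [← h0]
  · rw [Real.log_div h0.ne' (h0.trans_le (le_colSum hu i k)).ne', mul_sub]

theorem tendsto_logLik {v : ℕ → I → K → ℝ} (hv : ∀ N i k, 0 ≤ v N i k)
    (hlim : ∀ i k, Tendsto (fun N => v N i k) atTop (𝓝 (p i k))) :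
    Tendsto (fun N => logLik (v N)) atTop (𝓝 (logLik p)) := by
  have hp : ∀ i k, 0 ≤ p i k := fun i k => ge_of_tendsto' (hlim i k) fun N => hv N i k
  have hc : ∀ {f : ℕ → ℝ} {a : ℝ}, Tendsto f atTop (𝓝 a) →
      Tendsto (fun N => f N * Real.log (f N)) atTop (𝓝 (a * Real.log a)) :=
    fun h => (Real.continuous_mul_log.tendsto _).comp h
  rw [logLik_eq hp]
  simp only [fun N => logLik_eq (hv N)]
  refine Tendsto.sub ?_ ?_
  · exact tendsto_finsetSum _ fun i _ => tendsto_finsetSum _ fun k _ => hc (hlim i k)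
  · exact tendsto_finsetSum _ fun k _ => hc (tendsto_finsetSum _ fun i _ => hlim i k)

theorem isLittleO_mul_sub_mul {f g s : ℕ → ℝ} {a b : ℝ} (hg : Tendsto g atTop (𝓝 b))
    (hfs : (fun N => f N - a) =o[atTop] s) (hgs : (fun N => g N - b) =o[atTop] s) :
    (fun N => f N * g N - a * b) =o[atTop] s := by
  have h1 : (fun N => (f N - a) * g N) =o[atTop] fun N => s N * 1 :=
    hfs.mul_isBigO (hg.isBigO_one ℝ)
  have h2 : (fun N => a * (g N - b)) =o[atTop] s := hgs.const_mul_left a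
  simp only [mul_one] at h1
  exact (h1.add h2).congr_left fun N => by ring

/-- Under conditional independence, the likelihood ratio is of smaller order than the square of
the rate of convergence of the table. -/
theorem isLittleO_logLik_sub {v : ℕ → I → K → ℝ} {s : ℕ → ℝ} (hv : ∀ N i k, 0 ≤ v N i k)
    (hp : ∀ i k, 0 ≤ p i k)
    (hlim : ∀ i k, Tendsto (fun N => v N i k) atTop (𝓝 (p i k)))
    (hrate : ∀ i k, (fun N => v N i k - p i k) =o[atTop] s)
    (hsupp : ∀ i k, p i k = 0 → ∀ N, v N i k = 0)
    (hci : ∀ i k, p i k * (∑ i', merge π p i' (π k)) = (∑ i', p i' k) * merge π p i (π k)) :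
    (fun N => logLik (v N) - logLik (merge π (v N))) =o[atTop] fun N => s N ^ 2 := by
  have hm := tendsto_merge (π := π) hlim
  have hmr : ∀ i j, (fun N => merge π (v N) i j - merge π p i j) =o[atTop] s := by
    intro i j
    simp only [merge, ← Finset.sum_sub_distrib]
    exact IsLittleO.fun_sum fun k _ => hrate i k
  have hs : ∀ k, Tendsto (fun N => ∑ i, v N i k) atTop (𝓝 (∑ i, p i k)) :=
    fun k => tendsto_finsetSum _ fun i _ => hlim i k
  have hsr : ∀ k, (fun N => ∑ i, v N i k - ∑ i, p i k) =o[atTop] s := by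
    intro k
    simp only [← Finset.sum_sub_distrib]
    exact IsLittleO.fun_sum fun i _ => hrate i k
  have ht : ∀ j, Tendsto (fun N => ∑ i, merge π (v N) i j) atTop (𝓝 (∑ i, merge π p i j)) :=
    fun j => tendsto_finsetSum _ fun i _ => hm i j
  have htr : ∀ j, (fun N => ∑ i, merge π (v N) i j - ∑ i, merge π p i j) =o[atTop] s := by
    intro j
    simp only [← Finset.sum_sub_distrib]
    exact IsLittleO.fun_sum fun i _ => hmr i j
  have hcell : ∀ i k, (fun N => (v N i k - expected π (v N) i k) ^ 2 / expected π (v N) i k)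
      =o[atTop] fun N => s N ^ 2 := by
    intro i k
    rcases (hp i k).eq_or_lt with h0 | h0
    -- In a null cell independence makes the whole column or the merged cell null, hence empty in
    -- the data; the term is then a division by 0, which equals 0.
    · have hz : ∀ N, expected π (v N) i k = 0 := by
        intro N
        have := hci i k
        rw [← h0, zero_mul] at this
        rcases mul_eq_zero.1 this.symm with h | h
        · have : ∑ i', v N i' k = 0 := Finset.sum_eq_zero fun i' _ => hsupp i' k
            ((Finset.sum_eq_zero_iff_of_nonneg fun i _ => hp i k).1 h i' (Finset.mem_univ _)) N
          simp [expected, this]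
        · have : merge π (v N) i (π k) = 0 := Finset.sum_eq_zero fun k' hk' => hsupp i k'
            ((Finset.sum_eq_zero_iff_of_nonneg fun k _ => hp i k).1 h k' hk') N
          simp [expected, this]
      simp [hz]
    · have hT : 0 < ∑ i', merge π p i' (π k) :=
        (h0.trans_le (le_merge hp i k)).trans_le (le_colSum (merge_nonneg hp) i (π k))
      have hE : Tendsto (fun N => expected π (v N) i k) atTop (𝓝 (expected π p i k)) :=
        ((hs k).mul (hm i (π k))).div (ht (π k)) hT.ne'
      have hEpos : 0 < expected π p i k := expected_pos hp h0
      have hnum : (fun N => v N i k * (∑ i', merge π (v N) i' (π k)) -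
          (∑ i', v N i' k) * merge π (v N) i (π k)) =o[atTop] s := by
        have h1 := isLittleO_mul_sub_mul (ht (π k)) (hrate i k) (htr (π k))
        have h2 := isLittleO_mul_sub_mul (hm i (π k)) (hsr k) (hmr i (π k))
        refine (h1.sub h2).congr_left fun N => ?_
        rw [hci i k]
        ring
      have hdiff : (fun N => v N i k - expected π (v N) i k) =o[atTop] s := by
        have h1 : (fun N => (v N i k * (∑ i', merge π (v N) i' (π k)) -
          (∑ i', v N i' k) * merge π (v N) i (π k)) * (∑ i', merge π (v N) i' (π k))⁻¹)
            =o[atTop] fun N => s N * 1 :=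
          hnum.mul_isBigO (((ht (π k)).inv₀ hT.ne').isBigO_one ℝ)
        simp only [mul_one] at h1
        refine h1.congr' ?_ EventuallyEq.rfl
        filter_upwards [(ht (π k)).eventually_ne hT.ne'] with N hN
        rw [expected]
        field_simp
      have h2 : (fun N => (v N i k - expected π (v N) i k) ^ 2 * (expected π (v N) i k)⁻¹)
          =o[atTop] fun N => s N ^ 2 * 1 :=
        (hdiff.pow two_pos).mul_isBigO ((hE.inv₀ hEpos.ne').isBigO_one ℝ)
      simpa only [mul_one, div_eq_mul_inv] using h2
  have hchi : (fun N => ∑ i, ∑ k, (v N i k - expected π (v N) i k) ^ 2 / expected π (v N) i k)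
      =o[atTop] fun N => s N ^ 2 :=
    IsLittleO.fun_sum fun i _ => IsLittleO.fun_sum fun k _ => hcell i k
  refine IsBigO.trans_isLittleO (IsBigO.of_bound' (Eventually.of_forall fun N => ?_)) hchi
  have h1 : 0 ≤ logLik (v N) - logLik (merge π (v N)) := sub_nonneg.2 (logLik_merge_le (hv N))
  have h2 := logLik_sub_logLik_merge_le (π := π) (hv N)
  rwa [Real.norm_of_nonneg h1, Real.norm_of_nonneg (h1.trans h2)]

end Tables

/-! ### Almost sure size of sums of bounded independent variables -/

section Fluctuations

open Asymptotics Topology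
open scoped NNReal ENNReal

variable {Ω : Type*} [MeasurableSpace Ω] {μ : Measure Ω} [IsProbabilityMeasure μ] {X : ℕ → Ω → ℝ}

theorem hasSubgaussianMGF_sum (hm : ∀ k, Measurable (X k)) (hind : iIndepFun X μ)
    (hb : ∀ k ω, |X k ω| ≤ 1) (hc : ∀ k, ∫ ω, X k ω ∂μ = 0) (n : ℕ) :
    HasSubgaussianMGF (fun ω => ∑ k ∈ Finset.range n, X k ω) n μ := by
  have h : ∀ k ∈ Finset.range n, HasSubgaussianMGF (X k) 1 μ := by
    intro k _
    have := hasSubgaussianMGF_of_mem_Icc_of_integral_eq_zero (a := -1) (b := 1)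
      (hm k).aemeasurable (ae_of_all μ fun ω => abs_le.1 (hb k ω)) (hc k)
    convert this using 1
    ext
    norm_num
  simpa using HasSubgaussianMGF.sum_of_iIndepFun hind h

/-- The exponentials of the partial sums of independent centred variables form a submartingale. -/
theorem submartingale_exp_sum (hm : ∀ k, Measurable (X k)) (hind : iIndepFun X μ)
    (hb : ∀ k ω, |X k ω| ≤ 1) (hc : ∀ k, ∫ ω, X k ω ∂μ = 0) (t : ℝ) :
    Submartingale (fun n ω => Real.exp (t * ∑ k ∈ Finset.range (n + 1), X k ω))
      (Filtration.natural X fun k => (hm k).stronglyMeasurable) μ := by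
  set F := Filtration.natural X fun k => (hm k).stronglyMeasurable
  have hadX : ∀ n k, k ≤ n → Measurable[F n] (X k) := by
    intro n k hk
    exact ((Filtration.stronglyAdapted_natural fun k => (hm k).stronglyMeasurable) k).measurable.mono
      (F.mono hk) le_rfl
  have hadS : ∀ n, Measurable[F n] fun ω => Real.exp (t * ∑ k ∈ Finset.range (n + 1), X k ω) := by
    intro n
    refine Real.measurable_exp.comp (Measurable.const_mul ?_ t)
    exact Finset.measurable_fun_sum _ fun k hk => hadX n k (by simp at hk; omega)
  have hexp : ∀ n, Integrable (fun ω => Real.exp (t * ∑ k ∈ Finset.range (n + 1), X k ω)) μ :=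
    fun n => (hasSubgaussianMGF_sum hm hind hb hc (n + 1)).integrable_exp_mul t
  refine submartingale_of_setIntegral_le_succ (fun n => (hadS n).stronglyMeasurable) hexp ?_
  intro n s hs
  have hs' : MeasurableSet s := F.le n s hs
  -- By exp y ≥ 1 + y, the increment over s is at least t times the integral of g · X (n + 1), which
  -- vanishes because g depends on the past only.
  set g : Ω → ℝ := s.indicator fun ω => Real.exp (t * ∑ k ∈ Finset.range (n + 1), X k ω) with hg
  have hgm : Measurable[F n] g := (hadS n).indicator hs
  have hgi : Integrable g μ := (hexp n).indicator hs'
  have hindep : IndepFun g (X (n + 1)) μ := by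
    have h1 := hind.indep_comap_natural_of_lt (fun k => (hm k).stronglyMeasurable)
      (Nat.lt_succ_self n)
    exact (indep_of_indep_of_le_right h1 hgm.comap_le).symm
  have hXi : Integrable (X (n + 1)) μ :=
    Integrable.of_bound (hm _).aestronglyMeasurable 1 (ae_of_all μ fun ω => hb _ ω)
  have h0 : ∫ ω, g ω * X (n + 1) ω ∂μ = 0 := by
    have := hindep.integral_fun_mul_eq_mul_integral hgi.aestronglyMeasurable hXi.aestronglyMeasurable
    rw [this, hc, mul_zero]
  have hgX : Integrable (fun ω => g ω * X (n + 1) ω) μ := hindep.integrable_mul hgi hXi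
  rw [← integral_indicator hs', ← integral_indicator hs']
  calc ∫ ω, g ω ∂μ = ∫ ω, (g ω + t * (g ω * X (n + 1) ω)) ∂μ := by
        rw [integral_add hgi (hgX.const_mul t), integral_const_mul, h0, mul_zero, add_zero]
    _ ≤ _ := by
        refine integral_mono (hgi.add (hgX.const_mul t)) ((hexp (n + 1)).indicator hs') fun ω => ?_
        by_cases hω : ω ∈ s
        · simp only [hg, Set.indicator_of_mem hω]
          rw [Finset.sum_range_succ _ (n + 1), mul_add, Real.exp_add]
          have := Real.add_one_le_exp (t * X (n + 1) ω)
          nlinarith [Real.exp_pos (t * ∑ k ∈ Finset.range (n + 1), X k ω)]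
        · simp [hg, hω]

/-- A maximal form of Hoeffding's inequality. -/
theorem measure_exists_sum_ge_le (hm : ∀ k, Measurable (X k)) (hind : iIndepFun X μ)
    (hb : ∀ k ω, |X k ω| ≤ 1) (hc : ∀ k, ∫ ω, X k ω ∂μ = 0) (n : ℕ) {r : ℝ} (hr : 0 ≤ r) :
    μ {ω | ∃ j ≤ n, r ≤ ∑ k ∈ Finset.range (j + 1), X k ω} ≤
      ENNReal.ofReal (Real.exp (-(r ^ 2 / (2 * (n + 1))))) := by
  -- This t minimizes (n + 1) t² / 2 - t r, the exponent of the Chernoff bound.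
  set t : ℝ := r / (n + 1) with ht
  have ht0 : 0 ≤ t := by positivity
  have hsub := submartingale_exp_sum hm hind hb hc t
  set ε : ℝ≥0 := (Real.exp (t * r)).toNNReal with hε
  have hεr : (ε : ℝ) = Real.exp (t * r) := Real.coe_toNNReal _ (Real.exp_pos _).le
  have hmax := maximal_ineq hsub (fun n ω => (Real.exp_pos _).le) (ε := ε) n
  set A := {ω | (ε : ℝ) ≤ (Finset.range (n + 1)).sup' Finset.nonempty_range_add_one
    fun k => Real.exp (t * ∑ i ∈ Finset.range (k + 1), X i ω)} with hA
  have hsubset : {ω | ∃ j ≤ n, r ≤ ∑ k ∈ Finset.range (j + 1), X k ω} ⊆ A := by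
    rintro ω ⟨j, hj, hrj⟩
    refine le_trans ?_ (Finset.le_sup' (fun k => Real.exp (t * ∑ i ∈ Finset.range (k + 1), X i ω))
      (Finset.mem_range.2 (Nat.lt_succ_of_le hj)))
    rw [hεr]
    exact Real.exp_le_exp.2 (mul_le_mul_of_nonneg_left hrj ht0)
  have hS := hasSubgaussianMGF_sum hm hind hb hc (n + 1)
  have hI : ∫ ω in A, Real.exp (t * ∑ k ∈ Finset.range (n + 1), X k ω) ∂μ ≤
      Real.exp ((n + 1 : ℕ) * t ^ 2 / 2) :=
    (setIntegral_le_integral (hS.integrable_exp_mul t)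
      (ae_of_all μ fun ω => (Real.exp_pos _).le)).trans (by exact_mod_cast hS.mgf_le t)
  have hε0 : (ε : ℝ≥0∞) ≠ 0 := by
    simpa [hε] using Real.exp_pos (t * r)
  have h1 : (ε : ℝ≥0∞) * μ A ≤ ENNReal.ofReal (Real.exp ((n + 1 : ℕ) * t ^ 2 / 2)) :=
    hmax.trans (ENNReal.ofReal_le_ofReal hI)
  refine (measure_mono hsubset).trans ?_
  have h2 : μ A ≤ ENNReal.ofReal (Real.exp ((n + 1 : ℕ) * t ^ 2 / 2)) / ε := by
    rwa [ENNReal.le_div_iff_mul_le (Or.inl hε0) (Or.inl ENNReal.coe_ne_top), mul_comm]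
  refine h2.trans (le_of_eq ?_)
  have h3 : (ε : ℝ≥0∞) = ENNReal.ofReal (Real.exp (t * r)) := rfl
  rw [h3, ← ENNReal.ofReal_div_of_pos (Real.exp_pos _), ← Real.exp_sub]
  congr 2
  rw [ht]
  push_cast
  field_simp
  ring

theorem measure_exists_abs_sum_ge_le (hm : ∀ k, Measurable (X k)) (hind : iIndepFun X μ)
    (hb : ∀ k ω, |X k ω| ≤ 1) (hc : ∀ k, ∫ ω, X k ω ∂μ = 0) (n : ℕ) {r : ℝ} (hr : 0 ≤ r) :
    μ {ω | ∃ j ≤ n, r ≤ |∑ k ∈ Finset.range (j + 1), X k ω|} ≤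
      2 * ENNReal.ofReal (Real.exp (-(r ^ 2 / (2 * (n + 1))))) := by
  have hind' : iIndepFun (fun k ω => -X k ω) μ :=
    hind.comp (fun _ x => -x) fun _ => measurable_neg
  have h1 := measure_exists_sum_ge_le hm hind hb hc n hr
  have h2 := measure_exists_sum_ge_le (X := fun k ω => -X k ω) (fun k => (hm k).neg) hind'
    (fun k ω => by simpa using hb k ω) (fun k => by rw [integral_neg, hc, neg_zero]) n hr
  rw [two_mul]
  refine le_trans ?_ ((measure_union_le _ _).trans (add_le_add h1 h2))
  refine measure_mono ?_
  rintro ω ⟨j, hj, h⟩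
  rcases le_abs.1 h with h | h
  · exact Or.inl ⟨j, hj, h⟩
  · exact Or.inr ⟨j, hj, by simpa using h⟩

/-- Borel–Cantelli over the dyadic blocks 2 ^ m ≤ n < 2 ^ (m + 1): the maximal inequality bounds the
m-th failure by 2 exp(-δ m / 2). -/
theorem ae_eventually_abs_sum_le (hm : ∀ k, Measurable (X k)) (hind : iIndepFun X μ)
    (hb : ∀ k ω, |X k ω| ≤ 1) (hc : ∀ k, ∫ ω, X k ω ∂μ = 0) {ε : ℝ} (hε : 0 < ε) :
    ∀ᵐ ω ∂μ, ∀ᶠ n : ℕ in atTop,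
      |∑ k ∈ Finset.range n, X k ω| ≤ ε * √(n * Real.log n) := by
  -- One factor 2 is lost from 2 ^ (m + 1) ≤ 2 n, the other from m ≤ 2 log n.
  set δ : ℝ := ε ^ 2 / 4 with hδ
  have hδ0 : 0 < δ := by positivity
  let A : ℕ → Set Ω := fun m =>
    {ω | ∃ j ≤ 2 ^ (m + 1) - 1, √(δ * 2 ^ (m + 1) * m) ≤ |∑ k ∈ Finset.range (j + 1), X k ω|}
  have hA : ∀ m, μ (A m) ≤ ENNReal.ofReal (2 * Real.exp (-(δ / 2)) ^ m) := by
    intro m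
    refine (measure_exists_abs_sum_ge_le hm hind hb hc _ (Real.sqrt_nonneg _)).trans (le_of_eq ?_)
    rw [ENNReal.ofReal_mul two_pos.le, ENNReal.ofReal_ofNat, ← Real.exp_nat_mul,
      Real.sq_sqrt (by positivity)]
    congr 3
    rw [Nat.cast_sub Nat.one_le_two_pow]
    push_cast
    field_simp
    ring
  have hsum : ∑' m, μ (A m) ≠ ∞ := by
    refine ne_top_of_le_ne_top ?_ (ENNReal.tsum_le_tsum hA)
    have hs : Summable fun m : ℕ => 2 * Real.exp (-(δ / 2)) ^ m :=
      (summable_geometric_of_lt_one (Real.exp_pos _).le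
        (Real.exp_lt_one_iff.2 (by linarith))).mul_left 2
    rw [← ENNReal.ofReal_tsum_of_nonneg (fun m => by positivity) hs]
    exact ENNReal.ofReal_ne_top
  filter_upwards [ae_eventually_notMem hsum] with ω hω
  have hlog : Tendsto (fun n : ℕ => Nat.log 2 n) atTop atTop := by
    refine tendsto_atTop.2 fun b => ?_
    filter_upwards [eventually_ge_atTop (2 ^ b)] with n hn
    exact Nat.le_log_of_pow_le one_lt_two hn
  filter_upwards [hlog.eventually hω, eventually_ge_atTop 1] with n hn hn1
  set m := Nat.log 2 n with hm'
  have hlt : n < 2 ^ (m + 1) := Nat.lt_pow_succ_log_self one_lt_two n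
  have hle : 2 ^ m ≤ n := Nat.pow_log_le_self 2 (by omega)
  have h1 : |∑ k ∈ Finset.range n, X k ω| < √(δ * 2 ^ (m + 1) * m) := by
    by_contra hcon
    refine hn ⟨n - 1, by omega, ?_⟩
    rw [Nat.sub_add_cancel hn1]
    exact not_lt.1 hcon
  refine h1.le.trans ?_
  have hn0 : (0 : ℝ) < n := by exact_mod_cast hn1
  have hler : (2 : ℝ) ^ m ≤ n := by exact_mod_cast hle
  have hmlog : (m : ℝ) ≤ 2 * Real.log n := by
    have h2 : Real.log ((2 : ℝ) ^ m) ≤ Real.log n := Real.log_le_log (by positivity) hler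
    rw [Real.log_pow] at h2
    have h3 := Real.log_two_gt_d9
    nlinarith [Nat.cast_nonneg (α := ℝ) m]
  rw [show ε = √(ε ^ 2) from (Real.sqrt_sq hε.le).symm, ← Real.sqrt_mul (sq_nonneg _)]
  refine Real.sqrt_le_sqrt ?_
  calc δ * 2 ^ (m + 1) * m = 2 * δ * (2 ^ m * m) := by ring
    _ ≤ 2 * δ * (n * (2 * Real.log n)) := by gcongr
    _ = ε ^ 2 * (n * Real.log n) := by rw [hδ]; ring

/-- The partial sums of bounded independent centred variables are almost surely
`o(√(n log n))`. -/
theorem ae_isLittleO_sum (hm : ∀ k, Measurable (X k)) (hind : iIndepFun X μ)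
    (hb : ∀ k ω, |X k ω| ≤ 1) (hc : ∀ k, ∫ ω, X k ω ∂μ = 0) :
    ∀ᵐ ω ∂μ, (fun n : ℕ => ∑ k ∈ Finset.range n, X k ω) =o[atTop]
      fun n : ℕ => √(n * Real.log n) := by
  -- Almost sure events intersect only countably, so ε runs through 1 / (i + 1).
  have h : ∀ᵐ ω ∂μ, ∀ i : ℕ, ∀ᶠ n : ℕ in atTop,
      |∑ k ∈ Finset.range n, X k ω| ≤ 1 / ((i : ℝ) + 1) * √(n * Real.log n) :=
    ae_all_iff.2 fun i => ae_eventually_abs_sum_le hm hind hb hc Nat.one_div_pos_of_nat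
  filter_upwards [h] with ω hω
  refine IsLittleO.of_bound fun c hc0 => ?_
  obtain ⟨i, hi⟩ := exists_nat_one_div_lt hc0
  filter_upwards [hω i] with n hn
  rw [Real.norm_eq_abs, Real.norm_of_nonneg (Real.sqrt_nonneg _)]
  exact hn.trans (mul_le_mul_of_nonneg_right hi.le (Real.sqrt_nonneg _))

end Fluctuations

/-! ### Typical records and their contingency tables -/

section Consistency

open Asymptotics Topology

variable {V : Type*} {α : V → Type*}

open Classical in
/-- The relative frequency of `y` among the first `N` terms of the sequence `r`. -/
noncomputable def freq {β : Type*} (r : ℕ → β) (N : ℕ) (y : β) : ℝ :=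
  (∑ k ∈ Finset.range N, if r k = y then 1 else 0) / N

theorem freq_nonneg {β : Type*} (r : ℕ → β) (N : ℕ) (y : β) : 0 ≤ freq r N y :=
  div_nonneg (Finset.sum_nonneg fun k _ => by split_ifs <;> norm_num) (Nat.cast_nonneg N)

/-- A sequence of records whose frequencies approach the distribution `P` faster than
`√(log N / N)` and which avoids the null assignments. -/
def IsTypical {β : Type*} [MeasurableSpace β] (P : Measure β) (r : ℕ → β) : Prop :=
  (∀ y, (fun N : ℕ => freq r N y - P.real {y}) =o[atTop] fun N : ℕ => √(Real.log N / N)) ∧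
    ∀ y, P.real {y} = 0 → ∀ k, r k ≠ y

/-- Independent records with a common distribution on a finite space are typical. -/
theorem ae_isTypical {β : Type*} [Finite β] [MeasurableSpace β] [MeasurableSingletonClass β]
    {P : Measure β} {Ω : Type*} [MeasurableSpace Ω] {μ : Measure Ω} [IsProbabilityMeasure μ]
    {ξ : ℕ → Ω → β} (hm : ∀ k, Measurable (ξ k)) (hind : iIndepFun ξ μ)
    (hlaw : ∀ k, μ.map (ξ k) = P) : ∀ᵐ ω ∂μ, IsTypical P fun k => ξ k ω := by
  classical
  have hP : IsProbabilityMeasure P := hlaw 0 ▸ Measure.isProbabilityMeasure_map (hm 0).aemeasurable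
  have hreal : ∀ k y, μ.real (ξ k ⁻¹' {y}) = P.real {y} := fun k y => by
    rw [← hlaw k, map_measureReal_apply (hm k) (measurableSet_singleton y)]
  have h1 : ∀ᵐ ω ∂μ, ∀ y, (fun N : ℕ => ∑ k ∈ Finset.range N,
      ((if ξ k ω = y then (1 : ℝ) else 0) - P.real {y})) =o[atTop]
        fun N : ℕ => √(N * Real.log N) := by
    refine ae_all_iff.2 fun y => ?_
    have hφ : Measurable fun x : β => (if x = y then (1 : ℝ) else 0) - P.real {y} :=
      (Measurable.ite (measurableSet_singleton y) measurable_const measurable_const).sub_const _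
    refine ae_isLittleO_sum (X := fun k ω => (if ξ k ω = y then (1 : ℝ) else 0) - P.real {y})
      (fun k => hφ.comp (hm k)) (hind.comp _ fun _ => hφ) (fun k ω => ?_) fun k => ?_
    · have h0 : 0 ≤ P.real {y} := measureReal_nonneg
      have h1 : P.real {y} ≤ 1 := measureReal_le_one
      rw [abs_le]
      split_ifs <;> constructor <;> linarith
    · have hi : (fun ω => if ξ k ω = y then (1 : ℝ) else 0) =
          (ξ k ⁻¹' {y}).indicator fun _ => 1 := by
        funext ω
        simp [Set.indicator_apply]
      have hms : MeasurableSet (ξ k ⁻¹' {y}) := hm k (measurableSet_singleton y)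
      rw [integral_sub (hi ▸ (integrable_const _).indicator hms) (integrable_const _), hi,
        integral_indicator hms]
      simp [hreal]
  have h2 : ∀ᵐ ω ∂μ, ∀ y, P.real {y} = 0 → ∀ k, ξ k ω ≠ y := by
    refine ae_all_iff.2 fun y => ?_
    by_cases hy : P.real {y} = 0
    · have : ∀ᵐ ω ∂μ, ∀ k, ξ k ω ≠ y := by
        refine ae_all_iff.2 fun k => ?_
        have h0 : μ (ξ k ⁻¹' {y}) = 0 := by
          rw [← measureReal_eq_zero_iff, hreal, hy]
        exact measure_eq_zero_iff_ae_notMem.1 h0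
      filter_upwards [this] with ω hω _ using hω
    · exact ae_of_all μ fun ω h => absurd h hy
  filter_upwards [h1, h2] with ω hω1 hω2
  refine ⟨fun y => ?_, hω2⟩
  have h := (hω1 y).mul_isBigO (isBigO_refl (fun N : ℕ => ((N : ℝ))⁻¹) atTop)
  refine h.congr' ?_ ?_
  · filter_upwards [eventually_ge_atTop 1] with N hN
    have : (N : ℝ) ≠ 0 := by positivity
    rw [freq, Finset.sum_sub_distrib, Finset.sum_const, Finset.card_range, nsmul_eq_mul]
    field_simp
  · filter_upwards [eventually_ge_atTop 1] with N hN
    have : (0 : ℝ) < N := by positivity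
    rw [← Real.sqrt_sq (inv_pos.2 this).le, ← Real.sqrt_mul' _ (sq_nonneg _)]
    congr 1
    field_simp

open Classical in
/-- The contingency table of `X` against `Z` for the weights `w`. -/
noncomputable def table [Fintype (∀ i, α i)] (w : (∀ i, α i) → ℝ) (X : V) (Z : Finset V)
    (x : α X) (z : ∀ i : Z, α i) : ℝ :=
  ∑ y with y X = x ∧ ∀ i : Z, y i = z i, w y

/-- Restriction of an assignment to fewer variables. -/
def restrict {Z Z' : Finset V} (h : Z ⊆ Z') (z : ∀ i : Z', α i) : ∀ i : Z, α i :=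
  fun i => z ⟨i, h i.2⟩

section Table

variable [Fintype (∀ i, α i)] {w : (∀ i, α i) → ℝ} {X : V} {Z Z' : Finset V}

/-- Dropping parents amounts to merging columns, which turns nested parent sets into the setting of
`merge`. -/
theorem merge_table [Fintype (∀ i : Z', α i)] (h : Z ⊆ Z') :
    merge (restrict h) (table w X Z') = table w X Z := by
  classical
  funext x z
  have hmaps : ∀ y ∈ Finset.univ.filter (fun y : ∀ i, α i => y X = x ∧ ∀ i : Z, y i = z i),
      (fun i : Z' => y i) ∈ Finset.univ.filter fun z' : ∀ i : Z', α i => restrict h z' = z := by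
    intro y hy
    rw [Finset.mem_filter] at hy ⊢
    exact ⟨Finset.mem_univ _, funext fun i => hy.2.2 i⟩
  have hfib := Finset.sum_fiberwise_of_maps_to hmaps w
  rw [merge, table]
  convert hfib using 1
  refine Finset.sum_congr (by congr) fun z' hz' => ?_
  rw [table]
  refine Finset.sum_congr ?_ fun _ _ => rfl
  ext y
  have hz' : restrict h z' = z := (Finset.mem_filter.1 hz').2
  simp only [Finset.mem_filter, Finset.mem_univ, true_and]
  constructor
  · rintro ⟨h1, h2⟩
    refine ⟨⟨h1, fun i => ?_⟩, funext h2⟩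
    rw [← hz']
    exact h2 ⟨i, h i.2⟩
  · rintro ⟨⟨h1, -⟩, h2⟩
    exact ⟨h1, fun i => congrFun h2 i⟩

open Classical in
theorem sum_table [Fintype (α X)] (z : ∀ i : Z, α i) :
    ∑ x, table w X Z x z =
      ∑ y ∈ Finset.univ.filter (fun y : ∀ i, α i => ∀ i : Z, y i = z i), w y := by
  rw [← Finset.sum_fiberwise _ fun y : ∀ i, α i => y X]
  refine Finset.sum_congr rfl fun x _ => ?_
  rw [table, Finset.filter_filter]
  exact Finset.sum_congr (by ext; simp [and_comm]) fun _ _ => rfl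

theorem table_nonneg (hw : ∀ y, 0 ≤ w y) (x : α X) (z : ∀ i : Z, α i) : 0 ≤ table w X Z x z :=
  Finset.sum_nonneg fun y _ => hw y

variable [∀ i, MeasurableSpace (α i)] [MeasurableSingletonClass (∀ i, α i)]
  (P : Measure (∀ i, α i)) [IsFiniteMeasure P]

theorem table_measure (y : ∀ i, α i) :
    table (fun y => P.real {y}) X Z (y X) (fun i => y i) =
      P.real (agree ({X} ∪ (Z : Set V)) y) := by
  classical
  rw [table, sum_measureReal_singleton]
  congr 1
  ext y'
  simp [agree]

theorem sum_table_measure [Fintype (α X)] (y : ∀ i, α i) :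
    ∑ x, table (fun y => P.real {y}) X Z x (fun i => y i) = P.real (agree (Z : Set V) y) := by
  classical
  rw [sum_table, sum_measureReal_singleton]
  congr 1
  ext y'
  simp [agree]

/-- Conditional independence in terms of contingency tables. -/
theorem condIndep_iff_table [Fintype (α X)] [Fintype (∀ i : Z', α i)] [Nonempty (∀ i, α i)]
    (h : Z ⊆ Z') (hX : X ∉ Z') :
    CondIndep P {X} ((Z' : Set V) \ Z) Z ↔
      ∀ x z, table (fun y => P.real {y}) X Z' x z *
          (∑ x', merge (restrict h) (table (fun y => P.real {y}) X Z') x' (restrict h z)) =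
        (∑ x', table (fun y => P.real {y}) X Z' x' z) *
          merge (restrict h) (table (fun y => P.real {y}) X Z') x (restrict h z) := by
  classical
  have hcoe : ((Z' : Set V) \ Z) ∪ Z = Z' := Set.sdiff_union_of_subset (Finset.coe_subset.2 h)
  have key : ∀ y : ∀ i, α i,
      (P.real (agree ({X} ∪ ((Z' : Set V) \ Z) ∪ Z) y) * P.real (agree (Z : Set V) y) =
        P.real (agree ({X} ∪ (Z : Set V)) y) * P.real (agree (((Z' : Set V) \ Z) ∪ Z) y)) ↔
      table (fun y => P.real {y}) X Z' (y X) (fun i => y i) *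
          (∑ x', merge (restrict h) (table (fun y => P.real {y}) X Z') x'
            (restrict h fun i => y i)) =
        (∑ x', table (fun y => P.real {y}) X Z' x' (fun i => y i)) *
          merge (restrict h) (table (fun y => P.real {y}) X Z') (y X)
            (restrict h fun i => y i) := by
    intro y
    have hr : (restrict h fun i : Z' => y i) = fun i : Z => y i := rfl
    rw [merge_table h, hr, table_measure, table_measure, sum_table_measure, sum_table_measure,
      Set.union_assoc, hcoe, mul_comm (P.real (agree (Z' : Set V) y))]
  refine ⟨fun hci x z => ?_, fun ht y => (key y).2 (ht _ _)⟩
  obtain ⟨y₀⟩ := ‹Nonempty (∀ i, α i)›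
  -- Since X is not in Z', every cell (x, z) comes from a full assignment.
  let y : ∀ i, α i := Function.update (fun i => if hi : i ∈ Z' then z ⟨i, hi⟩ else y₀ i) X x
  have hyX : y X = x := Function.update_self _ _ _
  have hyZ : (fun i : Z' => y i) = z := by
    funext i
    have hi : (i : V) ≠ X := fun he => hX (he ▸ i.2)
    simp [y, Function.update_of_ne hi]
  have := (key y).1 (hci y)
  rwa [hyX, hyZ] at this

end Table

variable {r : ℕ → ∀ i, α i} {X : V} {Z Z' : Finset V}

theorem count_eq [Fintype (∀ i, α i)] (N : ℕ) (x : α X) (z : ∀ i : Z, α i) :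
    (count (fun k : Fin N => r k) X x Z z : ℝ) = N * table (freq r N) X Z x z := by
  classical
  have h1 : (count (fun k : Fin N => r k) X x Z z : ℝ) =
      ∑ k ∈ Finset.range N, if r k X = x ∧ ∀ i : Z, r k i = z i then (1 : ℝ) else 0 := by
    rw [count, Finset.card_filter, Finset.sum_range]
    push_cast
    exact Finset.sum_congr rfl fun k _ => by congr
  rcases Nat.eq_zero_or_pos N with rfl | hN
  · simp [h1]
  have hN' : (N : ℝ) ≠ 0 := by positivity
  rw [h1, table, Finset.mul_sum]
  simp only [freq, mul_div_cancel₀ _ hN']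
  rw [Finset.sum_comm]
  refine Finset.sum_congr rfl fun k _ => ?_
  rw [Finset.sum_ite_eq]
  simp

variable [∀ i, Fintype (α i)]

open Classical in
theorem localBIC_eq [Fintype (∀ i, α i)] (N : ℕ) :
    localBIC (fun k : Fin N => r k) X Z =
      N * logLik (table (freq r N) X Z) - 1 / 2 * Real.log N * dim α X Z := by
  rw [localBIC, ← logLik_smul, logLik]
  congr 1
  refine Finset.sum_congr rfl fun x _ => Finset.sum_congr rfl fun z _ => ?_
  push_cast
  simp only [count_eq, Pi.smul_apply, smul_eq_mul]

end Consistency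

/-! ### Nested score comparisons and the maximizing graphs -/

section Maximizers

open Asymptotics Topology

theorem tendsto_sqrt_log_div : Tendsto (fun N : ℕ => √(Real.log N / N)) atTop (𝓝 0) := by
  have h : Tendsto (fun N : ℕ => Real.log N / N) atTop (𝓝 0) :=
    Real.isLittleO_log_id_atTop.tendsto_div_nhds_zero.comp tendsto_natCast_atTop_atTop
  simpa using h.sqrt

section TypicalTable

variable {V : Type*} {α : V → Type*} [Fintype (∀ i, α i)] [∀ i, MeasurableSpace (α i)]
  {P : Measure (∀ i, α i)} {r : ℕ → ∀ i, α i} {X : V} {Z : Finset V}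

theorem IsTypical.table_rate (h : IsTypical P r) (x : α X) (z : ∀ i : Z, α i) :
    (fun N => table (freq r N) X Z x z - table (fun y => P.real {y}) X Z x z) =o[atTop]
      fun N : ℕ => √(Real.log N / N) := by
  simp only [table, ← Finset.sum_sub_distrib]
  exact IsLittleO.fun_sum fun y _ => h.1 y

theorem IsTypical.tendsto_table (h : IsTypical P r) (x : α X) (z : ∀ i : Z, α i) :
    Tendsto (fun N => table (freq r N) X Z x z) atTop
      (𝓝 (table (fun y => P.real {y}) X Z x z)) :=
  tendsto_sub_nhds_zero_iff.1 ((h.table_rate x z).trans_tendsto tendsto_sqrt_log_div)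

/-- A null cell consists of null assignments, which typical records avoid. -/
theorem IsTypical.table_eq_zero (h : IsTypical P r) (x : α X) (z : ∀ i : Z, α i)
    (h0 : table (fun y => P.real {y}) X Z x z = 0) (N : ℕ) : table (freq r N) X Z x z = 0 := by
  refine Finset.sum_eq_zero fun y hy => ?_
  have hy0 := (Finset.sum_eq_zero_iff_of_nonneg fun y _ => measureReal_nonneg).1 h0 y hy
  have : ∀ k, r k ≠ y := h.2 y hy0
  simp [freq, this]

end TypicalTable

variable {V : Type*} {α : V → Type*} [∀ i, Fintype (α i)]
  {r : ℕ → ∀ i, α i} {X : V} {Z Z' : Finset V}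

/-- Each extra parent at least doubles the number of columns, and |dom(X)| - 1 is positive: here
domains with at least two values matter. -/
theorem dim_lt (hα : ∀ i, Nontrivial (α i)) (h : Z ⊂ Z') : dim α X Z < dim α X Z' := by
  classical
  have hcard : ∀ i, (1 : ℝ) < Fintype.card (α i) := fun i => by
    exact_mod_cast Fintype.one_lt_card_iff_nontrivial.2 (hα i)
  refine mul_lt_mul_of_pos_left ?_ (sub_pos.2 (hcard X))
  obtain ⟨j, hj, hjZ⟩ := Finset.exists_of_ssubset h
  have hpos : (0 : ℝ) < ∏ i ∈ Z, (Fintype.card (α i) : ℝ) :=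
    Finset.prod_pos fun i _ => one_pos.trans (hcard i)
  rw [← Finset.prod_sdiff h.subset]
  refine lt_mul_of_one_lt_left hpos ?_
  have hj' : j ∈ Z' \ Z := Finset.mem_sdiff.2 ⟨hj, hjZ⟩
  rw [← Finset.mul_prod_erase _ _ hj']
  exact one_lt_mul_of_lt_of_le (hcard j) (Finset.one_le_prod fun i _ => (hcard i).le)

variable [Fintype V]

theorem coe_parents (G : Digraph V) (w : V) : (parents G w : Set V) = {u | G.Adj u w} := by
  ext u
  simp [mem_parents]

theorem parents_setParents_self (G : Digraph V) (w : V) (S : Finset V) :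
    parents (setParents G w S) w = S := by
  ext u
  simp [mem_parents, setParents]

theorem parents_setParents_of_ne (G : Digraph V) {v w : V} (S : Set V) (h : v ≠ w) :
    parents (setParents G w S) v = parents G v := by
  ext u
  simp [mem_parents, setParents, h]

/-- Improving the score of one family improves the score of the graph. -/
theorem BIC_lt_setParents {N : ℕ} {D : Fin N → ∀ i, α i} {G : Digraph V} {w : V} {S : Finset V}
    (h : localBIC D w (parents G w) < localBIC D w S) : BIC D G < BIC D (setParents G w S) := by
  refine Finset.sum_lt_sum (fun v _ => ?_) ⟨w, Finset.mem_univ w, ?_⟩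
  · rcases eq_or_ne v w with rfl | hv
    · rw [parents_setParents_self]
      exact h.le
    · rw [parents_setParents_of_ne G _ hv]
  · rwa [parents_setParents_self]

variable [∀ i, MeasurableSpace (α i)] [∀ i, MeasurableSingletonClass (α i)]
  {P : Measure (∀ i, α i)} [IsProbabilityMeasure P]

/-- Eventually the score prefers the larger of two nested parent sets, if the additional parents
are informative. -/
theorem IsTypical.eventually_localBIC_lt_of_not_condIndep (h : IsTypical P r) (hZ : Z ⊆ Z')
    (hX : X ∉ Z') (hci : ¬ CondIndep P {X} ((Z' : Set V) \ Z) Z) :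
    ∀ᶠ N : ℕ in atTop,
      localBIC (fun k : Fin N => r k) X Z < localBIC (fun k : Fin N => r k) X Z' := by
  classical
  have hne : Nonempty (∀ i, α i) := nonempty_of_isProbabilityMeasure P
  set p : (∀ i, α i) → ℝ := fun y => P.real {y} with hp
  have hp0 : ∀ y, 0 ≤ p y := fun y => measureReal_nonneg
  have hD : 0 < logLik (table p X Z') - logLik (table p X Z) := by
    rw [sub_pos, ← merge_table hZ]
    by_contra hcon
    refine hci ((condIndep_iff_table P hZ hX).2 fun x z => ?_)
    have he := eq_expected_of_logLik_le (table_nonneg hp0) (not_lt.1 hcon) x z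
    rw [expected] at he
    rcases eq_or_ne (∑ x', merge (restrict hZ) (table p X Z') x' (restrict hZ z)) 0 with h0 | h0
    · have hm : merge (restrict hZ) (table p X Z') x (restrict hZ z) = 0 :=
        (Finset.sum_eq_zero_iff_of_nonneg
          fun i _ => merge_nonneg (table_nonneg hp0) _ _).1 h0 x (Finset.mem_univ x)
      rw [h0, hm, mul_zero, mul_zero]
    · rw [eq_div_iff h0] at he
      exact he
  have hlim : Tendsto (fun N : ℕ => (logLik (table (freq r N) X Z') -
      logLik (table (freq r N) X Z)) - 1 / 2 * (dim α X Z' - dim α X Z) * (Real.log N / N))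
      atTop (𝓝 ((logLik (table p X Z') - logLik (table p X Z)) -
        1 / 2 * (dim α X Z' - dim α X Z) * 0)) := by
    refine ((tendsto_logLik (fun N => table_nonneg (freq_nonneg r N))
      fun x z => h.tendsto_table x z).sub (tendsto_logLik
        (fun N => table_nonneg (freq_nonneg r N)) fun x z => h.tendsto_table x z)).sub
      (Tendsto.const_mul _ ?_)
    exact Real.isLittleO_log_id_atTop.tendsto_div_nhds_zero.comp tendsto_natCast_atTop_atTop
  rw [mul_zero, sub_zero] at hlim
  filter_upwards [hlim.eventually_const_lt hD, eventually_ge_atTop 1] with N hN hN1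
  have hN0 : (0 : ℝ) < N := by positivity
  rw [localBIC_eq, localBIC_eq, ← sub_pos]
  refine (mul_pos hN0 hN).trans_eq ?_
  field_simp
  ring

/-- Eventually the score prefers the smaller of two nested parent sets, if the additional parents
are not informative. -/
theorem IsTypical.eventually_localBIC_lt_of_condIndep (h : IsTypical P r)
    (hα : ∀ i, Nontrivial (α i)) (hZ : Z ⊂ Z')
    (hX : X ∉ Z') (hci : CondIndep P {X} ((Z' : Set V) \ Z) Z) :
    ∀ᶠ N : ℕ in atTop,
      localBIC (fun k : Fin N => r k) X Z' < localBIC (fun k : Fin N => r k) X Z := by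
  classical
  have hne : Nonempty (∀ i, α i) := nonempty_of_isProbabilityMeasure P
  have hd : 0 < dim α X Z' - dim α X Z := sub_pos.2 (dim_lt hα hZ)
  have ho := isLittleO_logLik_sub (π := restrict hZ.subset)
    (fun N => table_nonneg (X := X) (Z := Z') (freq_nonneg r N))
    (table_nonneg fun y => measureReal_nonneg) (fun x z => h.tendsto_table x z)
    (fun x z => h.table_rate x z) (fun x z => h.table_eq_zero x z)
    ((condIndep_iff_table P hZ.subset hX).1 hci)
  -- The penalties differ by half the dimension gap times log N; a quarter leaves a strict margin.
  filter_upwards [ho.bound (c := (dim α X Z' - dim α X Z) / 4) (by positivity),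
    eventually_ge_atTop 2] with N hN hN2
  have hN0 : (0 : ℝ) < N := by positivity
  have hlog : 0 < Real.log N := Real.log_pos (by exact_mod_cast hN2)
  rw [merge_table, Real.sq_sqrt (by positivity), Real.norm_of_nonneg (r := Real.log N / N)
    (by positivity)] at hN
  have h1 := (Real.le_norm_self _).trans hN
  rw [localBIC_eq, localBIC_eq]
  have h2 := mul_le_mul_of_nonneg_left h1 hN0.le
  have h3 : N * ((dim α X Z' - dim α X Z) / 4 * (Real.log N / N)) =
    (dim α X Z' - dim α X Z) / 4 * Real.log N := by field_simp
  rw [h3] at h2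
  nlinarith [mul_pos hd hlog]

/-- Along a typical sequence of records, the maximizers of the score are eventually minimal
independence maps. -/
theorem IsTypical.eventually_isMinimalIMap (h : IsTypical P r) (hα : ∀ i, Nontrivial (α i)) :
    ∀ᶠ N : ℕ in atTop, ∀ G : Digraph V,
      MaximizesBIC (fun k : Fin N => r k) G → IsMinimalIMap G P := by
  classical
  have h1 : ∀ᶠ N : ℕ in atTop, ∀ (X : V) (Z Z' : Finset V), Z ⊆ Z' → X ∉ Z' →
      ¬ CondIndep P {X} ((Z' : Set V) \ Z) Z →
      localBIC (fun k : Fin N => r k) X Z < localBIC (fun k : Fin N => r k) X Z' := by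
    simp only [eventually_all]
    exact fun X Z Z' hZ hX hci => h.eventually_localBIC_lt_of_not_condIndep hZ hX hci
  have h2 : ∀ᶠ N : ℕ in atTop, ∀ (X : V) (Z Z' : Finset V), Z ⊂ Z' → X ∉ Z' →
      CondIndep P {X} ((Z' : Set V) \ Z) Z →
      localBIC (fun k : Fin N => r k) X Z' < localBIC (fun k : Fin N => r k) X Z := by
    simp only [eventually_all]
    exact fun X Z Z' hZ hX hci => h.eventually_localBIC_lt_of_condIndep hα hZ hX hci
  filter_upwards [h1, h2] with N hN1 hN2 G hG
  obtain ⟨hdag, hmax⟩ := hG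
  refine ⟨IsOrderedMarkov.isIMap hdag fun S w hwS hS hpa => ?_, fun H hHG hH => ?_⟩
  -- A dependence on S \ Pa(w) would make S a better parent set, and S is admissible because it
  -- contains no descendant of w.
  · by_contra hci
    rw [← coe_parents, ← Set.coe_toFinset S] at hci
    have hlt := hN1 w (parents G w) S.toFinset
      (fun u hu => Set.mem_toFinset.2 (hpa (mem_parents.1 hu))) (by simpa using hwS) hci
    refine absurd (hmax _ (hdag.setParents (w := w) (S := S.toFinset) fun s hs => ?_))
      (not_le.2 (BIC_lt_setParents hlt))
    replace hs : s ∈ S := by simpa using hs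
    refine ⟨fun he => hwS (he ▸ hs), fun hd => hwS ?_⟩
    induction hd with
    | single hwb => exact hS _ _ hwb hs
    | tail _ hbc ih => exact ih (hS _ _ hbc hs)
  · obtain ⟨hle, hnle⟩ := lt_iff_le_not_ge.1 hHG
    obtain ⟨u, w, huG, huH⟩ : ∃ u w, G.Adj u w ∧ ¬ H.Adj u w := by
      by_contra hcon
      push Not at hcon
      exact hnle fun u w huw => hcon u w huw
    have hss : parents H w ⊂ parents G w := by
      refine Finset.ssubset_iff_subset_ne.2 ⟨fun v hv => mem_parents.2 (hle (mem_parents.1 hv)), ?_⟩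
      intro he
      exact huH (mem_parents.1 (he ▸ mem_parents.2 huG))
    have hww : w ∉ parents G w := fun hw => hdag w (.single (mem_parents.1 hw))
    have hnd : ∀ v, G.Adj v w → v ≠ w ∧ ¬ IsDescendant G w v :=
      fun v hv => ⟨fun he => hdag w (.single (he ▸ hv)), fun hd => hdag w (hd.tail hv)⟩
    -- The parents of w in G are nondescendants of w in G, hence in H.
    have hsep : DSep H {w} ((parents G w : Set V) \ parents H w) (parents H w) := by
      rw [coe_parents H]
      refine (hdag.mono hle).dSep_parents w _ fun b hb => ?_
      obtain ⟨hb1, hb2⟩ := hb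
      rw [Finset.mem_coe, mem_parents] at hb1
      refine ⟨(hnd b hb1).1, fun hd => (hnd b hb1).2 ?_, hb2⟩
      exact Relation.TransGen.mono (fun _ _ hab => hle hab) _ _ hd
    have hci := hH {w} ((parents G w : Set V) \ parents H w) (parents H w)
      (Set.disjoint_singleton_left.2 fun hw => hww hw.1)
      (Set.disjoint_singleton_left.2 fun hw => hww (hss.subset hw)) Set.disjoint_sdiff_left hsep
    refine absurd (hmax _ (hdag.setParents (w := w) (S := parents H w) fun s hs => ?_))
      (not_le.2 (BIC_lt_setParents (hN2 w _ _ hss hww hci)))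
    exact hnd s (hle (mem_parents.1 hs))

end Maximizers

end LatentBN

theorem proposition4
    {V : Type*} [Fintype V] {α : V → Type*} [∀ i, Fintype (α i)]
    [∀ i, MeasurableSpace (α i)] [∀ i, MeasurableSingletonClass (α i)]
    -- the observed variables; the hidden ones are those outside `XO`
    (XO : Finset V) (hα : ∀ i ∈ XO, Nontrivial (α i))
    (Pstar : Measure (∀ i, α i)) [IsProbabilityMeasure Pstar]
    (Gstar : Digraph V) (hdag : LatentBN.IsDAG Gstar)
    (hperfect : LatentBN.IsPerfectMap Gstar Pstar)
    -- the i.i.d. records generated by `Pstar`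
    {Ω : Type*} [MeasurableSpace Ω] (μ : Measure Ω) [IsProbabilityMeasure μ]
    (R : ℕ → Ω → ∀ i, α i) (hmeas : ∀ k, Measurable (R k))
    (hindep : iIndepFun R μ) (hlaw : ∀ k, μ.map (R k) = Pstar) :
    ∀ᵐ ω ∂μ, ∀ᶠ N : ℕ in atTop, ∀ G : Digraph XO,
      LatentBN.MaximizesBIC (LatentBN.project XO fun k : Fin N => R k ω) G →
        LatentBN.IsMinimalIMap G (LatentBN.marginal XO Pstar) := by
  have hφ : Measurable fun (x : ∀ i, α i) (i : XO) => x i :=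
    measurable_pi_lambda _ fun i => measurable_pi_apply _
  have hP : IsProbabilityMeasure (LatentBN.marginal XO Pstar) :=
    Measure.isProbabilityMeasure_map hφ.aemeasurable
  -- The projected records are themselves independent, with the marginal as law.
  have htyp := LatentBN.ae_isTypical (P := LatentBN.marginal XO Pstar)
    (ξ := fun k ω (i : XO) => R k ω i) (fun k => hφ.comp (hmeas k))
    (hindep.comp (fun _ x (i : XO) => x i) fun _ => hφ) fun k => by
      rw [LatentBN.marginal, ← hlaw k, Measure.map_map hφ (hmeas k)]
      rfl
  filter_upwards [htyp] with ω hω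
  exact hω.eventually_isMinimalIMap fun i => hα i i.2
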